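/- **Setting.** A structured system $(\bar A,\bar B,\bar C)$ consists of matrices $\bar A\in\{0,\star\}^{n\times n}$, $\bar B\in\{0,\star\}^{n\times m}$, $\bar C\in\{0,\star\}^{p\times n}$. A real matrix is a realization of a $\{0,\star\}$-matrix if it vanishes wherever that matrix has a $0$. Inputs and outputs are dedicated: each column of $\bar B$ and each row of $\bar C$ has exactly one $\star$. For $\bar K\in\{0,\star\}^{m\times p}$, the closed loop $(\bar A,\bar B,\bar C,\bar K)$ has no structurally fixed modes if there are real realizations $A,B,C$ of $\bar A,\bar B,\bar C$ with $\bigcap_{K}\sigma(A+BKC)=\emptyset$, where $K$ runs over all real realizations of $\bar K$ and $\sigma$ is the set of complex eigenvalues. Let $P$ be a cost matrix with entries $P_{ij}\in[0,\infty]$ ($P_{ij}$ is the cost of the feedback edge $(y_j,u_i)$ from output $j$ to input $i$; $\infty$ means infeasible), and let $P(\bar K)=\sum_{(i,j):\bar K_{ij}=\star}P_{ij}$. *Problem 1* is to minimize $P(\bar K)$ over the set $\mathcal K$ of all $\bar K\in\{0,\star\}^{m\times p}$ for which $(\bar A,\bar B,\bar C,\bar K)$ has no structurally fixed modes. The digraph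 $\mathcal D(\bar A)$ has vertices $x_1,\dots,x_n$ and an edge $(x_j,x_i)$ whenever $\bar A_{ij}=\star$; $\mathcal D(\bar A,\bar B,\bar C)$ has in addition vertices $u_j$, $y_i$, an edge $(u_j,x_i)$ whenever $\bar B_{ij}=\star$, and an edge $(x_j,y_i)$ whenever $\bar C_{ij}=\star$. The bipartite graph $\mathcal B(\bar A)$ has parts $\{x_1',\dots,x_n'\}$ and $\{x_1,\dots,x_n\}$ and an edge between $x_j'$ and $x_i$ whenever $\bar A_{ji}=\star$. A vertex $v$ is an ancestor of $w$, and $w$ a descendant of $v$, if there is a directed path (possibly of length $0$) from $v$ to $w$. The DAG $\mathcal D_A$ has as vertices the strongly connected components of $\mathcal D(\bar A)$, with an edge $(N,M)$, $N\ne M$, whenever $\mathcal D(\bar A)$ has an edge from a state in $N$ to a state in $M$. A feedback edge $(y_j,u_i)$ covers $N$ if $u_i$ is attached to a state in an ancestor of $N$ and $y_j$ to a state in a descendant of $N$ in $\mathcal D_A$. $\mathrm{Tree}(N)$ is the subgraph of $\mathcal D_A$ on $N$ and its descendants, and $\mathrm{Forest}(N,e)$ the subgraph of $\mathrm{Tree}(N)$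 on the nodes not covered by $e$; it is composed of disjoint subtrees. **Algorithm 6.** Let $\mathcal D_A$ have the root $N_0$, and let $L_f$ be the set of nodes at distance $f-1$ from $N_0$, for $f=1,\dots,\Delta$. For $f=\Delta,\dots,1$ and each node $N\in L_f$ (in any order): for every feedback edge $e$ covering $N$ let $F(N,e)$ be the union of the sets $Z(M)$ already computed, over the roots $M$ of the subtrees of which $\mathrm{Forest}(N,e)$ is composed, and let $c(F(N,e))$ be the sum of the costs of its edges; put $c(Z(N))=\min_{e=(y_j,u_i)}\bigl(P_{ij}+c(F(N,e))\bigr)$ over the edges $e$ covering $N$, and $Z(N)=\{e\}\cup F(N,e)$ for an edge $e$ attaining this minimum, ties being broken arbitrarily (the algorithm fails if no edge covers $N$). Return $Z(N_0)$ and $c(Z(N_0))$. **Theorem 8.** Consider a structured system with dedicated inputs and outputs and a cost matrix $P$ such that - (back-edge assumption) $P_{ij}=\infty$ whenever $u_i$ is not an ancestor of $y_j$ in $\mathcal D(\bar A,\bar B,\bar C)$; - (hierarchical network) $\mathcal D_A$ has a root without incoming edges, and every other node of $\mathcal D_A$ has a unique parent; - $\mathcal B(\bar A)$ has a perfect matching.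 Then the output of Algorithm 6 is an optimal solution to Problem 1: for every order of the nodes within the layers and every way of breaking ties, if the algorithm returns $H$ and $c$, then the matrix $\bar K$ with $\bar K_{ij}=\star$ exactly for $(y_j,u_i)\in H$ minimizes $P(\cdot)$ over $\mathcal K$, and $c=P(\bar K)$; and the algorithm does return an output whenever $\mathcal K\neq\emptyset$. -/

import Mathlib

open scoped ENNReal

noncomputable section

namespace FeedbackSelection

/-! ### Directed graphs -/

section Digraphs

variable {V : Type*}

/-- `v` is an ancestor of `w` (and `w` a descendant of `v`): there is a directed path from `v` to
`w`. The path of length zero is allowed, so that every vertex is an ancestor of itself. -/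
def Ancestor (D : Digraph V) (v w : V) : Prop := Relation.ReflTransGen D.Adj v w

/-- `PathOfLength D k v w`: there is a directed walk with `k` edges from `v` to `w`. -/
inductive PathOfLength (D : Digraph V) : ℕ → V → V → Prop
  | nil (v : V) : PathOfLength D 0 v v
  | snoc {k : ℕ} {u v w : V} : PathOfLength D k u v → D.Adj v w → PathOfLength D (k + 1) u w

/-- The number of edges in a shortest directed path from `v` to `w`
(only used when there is such a path). -/
def distance (D : Digraph V) (v w : V) : ℕ := sInf {k | PathOfLength D k v w}

/-- `v` is a parent of `w`. -/
def Parent (D : Digraph V) (v w : V) : Prop := D.Adj v w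

/-- Every vertex other than `root` has a unique parent, and `root` has no incoming edge. -/
def IsHierarchical (D : Digraph V) (root : V) : Prop :=
  (∀ v, ¬ Parent D v root) ∧ ∀ w, w ≠ root → ∃! v, Parent D v w

/-- The layer `L_f`: the vertices at distance `f - 1` from the root. -/
def layer (D : Digraph V) (root : V) (f : ℕ) : Set V :=
  {v | Ancestor D root v ∧ distance D root v + 1 = f}

open scoped Classical in
/-- The index `Δ` of the bottom layer. -/
def numLayers [Fintype V] (D : Digraph V) (root : V) : ℕ :=
  Finset.univ.sup fun v => if Ancestor D root v then distance D root v + 1 else 0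

end Digraphs

/-! ### Structured systems -/

/-- A structured matrix, with entries in `{0, ⋆}`: `true` stands for `⋆`, `false` for `0`. -/
abbrev StructuredMatrix (k l : ℕ) := Matrix (Fin k) (Fin l) Bool

/-- The real matrix `M` is a numerical realization of the structured matrix `S`: the entry of `M`
is zero wherever the entry of `S` is zero. -/
def Realizes {k l : ℕ} (M : Matrix (Fin k) (Fin l) ℝ) (S : StructuredMatrix k l) : Prop :=
  ∀ i j, S i j = false → M i j = 0

/-- A structured system with `n` states, `m` inputs and `p` outputs. -/
structure StructuredSystem (n m p : ℕ) where
  /-- the structured state matrix -/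
  A : StructuredMatrix n n
  /-- the structured input matrix -/
  B : StructuredMatrix n m
  /-- the structured output matrix -/
  C : StructuredMatrix p n

/-- The vertices of the system digraph. -/
inductive Node (n m p : ℕ)
  | state (i : Fin n) : Node n m p
  | input (i : Fin m) : Node n m p
  | output (i : Fin p) : Node n m p

/-- A feedback edge `(y_j, u_i)` from an output to an input, as the pair `(j, i)`. -/
abbrev FeedbackEdge (m p : ℕ) := Fin p × Fin m

/-- A cost matrix: `P i j` is the cost of feeding the `j`-th output to the `i`-th input;
the value `∞` means that this connection is infeasible. -/
abbrev CostMatrix (m p : ℕ) := Matrix (Fin m) (Fin p) ℝ≥0∞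

namespace StructuredSystem

variable {n m p : ℕ} (S : StructuredSystem n m p)

/-- Dedicated inputs and outputs: every input actuates exactly one state, and
every output senses exactly one state. -/
def IsDedicated : Prop :=
  (∀ j : Fin m, ∃! i : Fin n, S.B i j = true) ∧ ∀ j : Fin p, ∃! i : Fin n, S.C j i = true

/-- The closed-loop structured system with feedback pattern `K` has no structurally fixed modes:
for some numerical realization `(A, B, C)`, no complex number is an eigenvalue of `A + B K' C` for
all real feedback matrices `K'` with the pattern `K`. -/
def NoStructurallyFixedModes (K : StructuredMatrix m p) : Prop :=
  ∃ (A : Matrix (Fin n) (Fin n) ℝ) (B : Matrix (Fin n) (Fin m) ℝ) (C : Matrix (Fin p) (Fin n) ℝ),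
    Realizes A S.A ∧ Realizes B S.B ∧ Realizes C S.C ∧
      ⋂ K' ∈ {K' : Matrix (Fin m) (Fin p) ℝ | Realizes K' K},
        spectrum ℂ ((A + B * K' * C).map (algebraMap ℝ ℂ)) = ∅

/-- The set of feasible solutions of the feedback selection problem. -/
def feasibleSet : Set (StructuredMatrix m p) := {K | S.NoStructurallyFixedModes K}

/-- The cost `P(K)` of a feedback matrix: the sum of the costs of its `⋆` entries. -/
def matrixCost (P : CostMatrix m p) (K : StructuredMatrix m p) : ℝ≥0∞ :=
  ∑ i, ∑ j, if K i j = true then P i j else 0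

/-- `K` is an optimal solution of the feedback selection problem. -/
def IsOptimalSolution (P : CostMatrix m p) (K : StructuredMatrix m p) : Prop :=
  K ∈ S.feasibleSet ∧ ∀ K' ∈ S.feasibleSet, matrixCost P K ≤ matrixCost P K'

/-- The state digraph `D(A)`, with an edge `(x_j, x_i)` whenever `A i j = ⋆`. -/
def stateDigraph : Digraph (Fin n) where
  Adj j i := S.A i j = true

/-- The system digraph `D(A, B, C)` on states, inputs and outputs. -/
def systemDigraph : Digraph (Node n m p) where
  Adj
    | .state j, .state i => S.A i j = true
    | .input j, .state i => S.B i j = true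
    | .state j, .output i => S.C i j = true
    | _, _ => False

/-- The state bipartite graph `B(A)`, where `Sum.inl j` is `x'_j` and `Sum.inr i` is `x_i`:
there is an edge between `x'_j` and `x_i` if and only if `(x_i, x_j)` is an edge of `D(A)`. -/
def stateBipartiteGraph : SimpleGraph (Fin n ⊕ Fin n) where
  Adj
    | .inl j, .inr i => S.stateDigraph.Adj i j
    | .inr i, .inl j => S.stateDigraph.Adj i j
    | _, _ => False
  symm := ⟨by rintro (_ | _) (_ | _) h <;> exact h⟩
  loopless := ⟨by rintro (_ | _) h <;> exact h⟩

/-- `B(A)` has a perfect matching. -/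
def HasPerfectMatching : Prop :=
  ∃ M : S.stateBipartiteGraph.Subgraph, M.IsPerfectMatching

/-- The back-edge assumption: feeding the output `y_j` to the input `u_i` is infeasible unless
`u_i` is an ancestor of `y_j` in `D(A, B, C)`. -/
def BackEdgeAssumption (P : CostMatrix m p) : Prop :=
  ∀ i j, ¬ Ancestor S.systemDigraph (.input i) (.output j) → P i j = ∞

/-- Two states are strongly connected if there are directed paths in both directions. -/
def sccSetoid : Setoid (Fin n) where
  r x y := Ancestor S.stateDigraph x y ∧ Ancestor S.stateDigraph y x
  iseqv :=
    ⟨fun _ => ⟨Relation.ReflTransGen.refl, Relation.ReflTransGen.refl⟩,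
     fun h => ⟨h.2, h.1⟩,
     fun h h' => ⟨h.1.trans h'.1, h'.2.trans h.2⟩⟩

/-- The strongly connected components of `D(A)`. -/
def SCC : Type := Quotient S.sccSetoid

/-- The strongly connected component of a state. -/
def scc (x : Fin n) : S.SCC := Quotient.mk S.sccSetoid x

open scoped Classical in
instance : Fintype S.SCC := inferInstanceAs (Fintype (Quotient S.sccSetoid))

/-- The DAG of strongly connected components: there is an edge between two different components if
and only if `D(A)` has an edge from a state of the first one to a state of the second one. -/
def sccDAG : Digraph S.SCC where
  Adj N M := N ≠ M ∧ ∃ x y : Fin n, S.scc x = N ∧ S.scc y = M ∧ S.stateDigraph.Adj x y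

/-! ### The dynamic programming algorithm -/

/-- The states in the components which are ancestors of `N`. -/
def ancestorStates (N : S.SCC) : Set (Fin n) := {x | Ancestor S.sccDAG (S.scc x) N}

/-- The states in the components which are descendants of `N`. -/
def descendantStates (N : S.SCC) : Set (Fin n) := {x | Ancestor S.sccDAG N (S.scc x)}

/-- The inputs connected to a state in an ancestor of `N`. -/
def inputSet (N : S.SCC) : Set (Fin m) := {i | ∃ x ∈ S.ancestorStates N, S.B x i = true}

/-- The outputs connected from a state in a descendant of `N`. -/
def outputSet (N : S.SCC) : Set (Fin p) := {j | ∃ x ∈ S.descendantStates N, S.C j x = true}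

open scoped Classical in
/-- The feedback edges which cover `N`. -/
def coveringEdges (N : S.SCC) : Finset (FeedbackEdge m p) :=
  {e | e.1 ∈ S.outputSet N ∧ e.2 ∈ S.inputSet N}

/-- The vertices of the subtree rooted at `N`: the node `N` and all its descendants. -/
def tree (N : S.SCC) : Set S.SCC := {M | Ancestor S.sccDAG N M}

/-- The vertices of the forest of `N` and `e`: the nodes of `tree N` not covered by `e`. -/
def forest (N : S.SCC) (e : FeedbackEdge m p) : Set S.SCC :=
  {M | M ∈ S.tree N ∧ e ∉ S.coveringEdges M}

open scoped Classical in
/-- The roots of the disjoint subtrees of which the forest of `N` and `e` is composed. -/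
def forestRoots (N : S.SCC) (e : FeedbackEdge m p) : Finset S.SCC :=
  {M | M ∈ S.forest N e ∧ ∀ M' ∈ S.forest N e, ¬ Parent S.sccDAG M' M}

/-- The memory of the algorithm: for every node `N`, the edge set `Z(N)` and its cost `c(Z(N))`. -/
abbrev Table := S.SCC → Finset (FeedbackEdge m p) × ℝ≥0∞

/-- The cost of a set of feedback edges. -/
def edgeCost (P : CostMatrix m p) (H : Finset (FeedbackEdge m p)) : ℝ≥0∞ :=
  ∑ e ∈ H, P e.2 e.1

open scoped Classical in
/-- The edge set `F(N, e)` for the forest of `N` and `e`: the union of the edge sets already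
computed for the subtrees of which the forest is composed. -/
def forestEdges (T : S.Table) (N : S.SCC) (e : FeedbackEdge m p) : Finset (FeedbackEdge m p) :=
  (S.forestRoots N e).biUnion fun M => (T M).1

/-- The cost `P_{ij} + c(F(N, e))` of covering `tree N` by means of `e = (y_j, u_i)`. -/
def treeCost (P : CostMatrix m p) (T : S.Table) (N : S.SCC) (e : FeedbackEdge m p) : ℝ≥0∞ :=
  P e.2 e.1 + edgeCost P (S.forestEdges T N e)

open scoped Classical in
/-- The edges covering `N` at which the minimum of `treeCost` is attained. -/
def minimizers (P : CostMatrix m p) (T : S.Table) (N : S.SCC) (h : (S.coveringEdges N).Nonempty) :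
    Finset (FeedbackEdge m p) :=
  {e ∈ S.coveringEdges N | (S.coveringEdges N).inf' h (S.treeCost P T N) = S.treeCost P T N e}

theorem minimizers_nonempty (P : CostMatrix m p) (T : S.Table) (N : S.SCC)
    (h : (S.coveringEdges N).Nonempty) : (S.minimizers P T N h).Nonempty := by
  classical
  obtain ⟨e, he, hmin⟩ := Finset.exists_mem_eq_inf' h (S.treeCost P T N)
  exact ⟨e, by simp only [minimizers, Finset.mem_filter]; exact ⟨he, hmin⟩⟩

/-- A rule that tells which of several minimizing edges is taken at each node. -/
abbrev TieBreak := S.SCC → (M : Finset (FeedbackEdge m p)) → M.Nonempty → {e // e ∈ M}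

open scoped Classical in
/-- The body of the two loops: compute `Z(N)` and `c(Z(N))`. The algorithm fails (`none`) if
no feedback edge covers `N`, since there is nothing to minimize over. -/
def visit (P : CostMatrix m p) (tie : S.TieBreak) (T : S.Table) (N : S.SCC) : Option S.Table :=
  if h : (S.coveringEdges N).Nonempty then
    let c := (S.coveringEdges N).inf' h (S.treeCost P T N)
    let e : FeedbackEdge m p := (tie N (S.minimizers P T N h) (S.minimizers_nonempty P T N h)).1
    some (Function.update T N (insert e (S.forestEdges T N e), c))
  else none

/-- An enumeration of the nodes of each layer. -/
def IsLayerEnumeration (root : S.SCC) (enum : ℕ → List S.SCC) : Prop :=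
  ∀ f, (enum f).Nodup ∧ ∀ N, N ∈ enum f ↔ N ∈ layer S.sccDAG root f

/-- The order in which the nodes are visited: for `f = Δ, …, 1`, the nodes of the layer `L_f`. -/
def visitOrder (root : S.SCC) (enum : ℕ → List S.SCC) : List S.SCC :=
  (List.range (numLayers S.sccDAG root)).reverse.flatMap fun f => enum (f + 1)

/-- The dynamic programming algorithm. Starting from an empty table, it visits the nodes layer by
layer from the bottom to the top, and returns `Z(root)` and `c(Z(root))`. -/
def hierarchicalAlgorithm (P : CostMatrix m p) (root : S.SCC) (enum : ℕ → List S.SCC)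
    (tie : S.TieBreak) : Option (Finset (FeedbackEdge m p) × ℝ≥0∞) :=
  ((S.visitOrder root enum).foldlM (S.visit P tie) fun _ => (∅, 0)).map fun T => T root

/-- The feedback matrix with `⋆` entries exactly at the edges of `H`. -/
def feedbackMatrix (H : Finset (FeedbackEdge m p)) : StructuredMatrix m p :=
  fun i j => decide ((j, i) ∈ H)

end StructuredSystem

end FeedbackSelection

end

noncomputable section

namespace FeedbackSelection

/-! ### The order of the components -/

/-! The proof replaces the spectral condition by a covering problem on the tree of components, and
then shows that the recursion solves the covering problem exactly.

A pattern of finite cost contains only back edges, and for such a pattern the absence of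
structurally fixed modes means that each component is covered by one of its edges. Necessity is
`exists_mem_coveringEdges_of_backEdges`: around an uncovered component the closed loop is block
triangular, and the diagonal block of the component receives no feedback, so its eigenvalues are
fixed. Sufficiency is `noStructurallyFixedModes_of_covered`. The perfect matching is a permutation
supported on the pattern of `A`, and it makes a generic realization have simple eigenvalues and be
observable and controllable wherever paths permit (`exists_generic`). At an eigenvalue `μ` the
adjugate of `μ - A` then has nonzero trace, so some diagonal entry, say at `x`, is nonzero. Its rows
and columns are eigenvectors, which spreads the nonvanishing to the entry selected by any edge
covering the component of `x` (`exists_realization_adjugate_ne_zero`). Unit gain on that one edge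
changes the determinant by this entry and so removes `μ` from the spectrum.

For the covering problem, the nodes below `N` that an edge `e` covering `N` leaves uncovered form
disjoint full subtrees. An edge covering a node of such a subtree has its output state inside the
subtree, so it serves no other one. Hence a covering containing `e` splits into `e`, disjoint
coverings of the subtrees, and possibly superfluous edges, and the costs add
(`treeCost_le_of_coversTree`). Induction along the layers gives `hierarchicalAlgorithm_solvesTree`.
The algorithm can fail only at a component that no edge covers, which `coveringEdges_nonempty`
excludes once a feasible pattern exists. -/

theorem Ancestor.refl {V : Type*} {D : Digraph V} (v : V) : Ancestor D v v :=
  Relation.ReflTransGen.refl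

theorem Ancestor.trans {V : Type*} {D : Digraph V} {u v w : V} (h : Ancestor D u v)
    (h' : Ancestor D v w) : Ancestor D u w :=
  Relation.ReflTransGen.trans h h'

theorem Ancestor.exists_parent {V : Type*} {D : Digraph V} {v w : V} (h : Ancestor D v w)
    (hne : v ≠ w) : ∃ u, Ancestor D v u ∧ Parent D u w := by
  rcases Relation.ReflTransGen.cases_tail h with h | h
  · exact absurd h.symm hne
  · exact h

theorem IsHierarchical.parent_unique {V : Type*} {D : Digraph V} {root : V}
    (hD : IsHierarchical D root) {u v w : V} (hu : Parent D u w) (hv : Parent D v w) : u = v := by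
  by_cases hw : w = root
  · exact absurd (hw ▸ hu) (hD.1 u)
  · exact (hD.2 w hw).unique hu hv

/-- In a hierarchical network the ancestors of a node form a chain. -/
theorem IsHierarchical.comparable {V : Type*} {D : Digraph V} {root : V}
    (hD : IsHierarchical D root) {u v w : V} (hu : Ancestor D u w) (hv : Ancestor D v w) :
    Ancestor D u v ∨ Ancestor D v u := by
  induction hu with
  | refl => exact Or.inr hv
  | @tail a b hua hab ih =>
    by_cases hvb : v = b
    · exact Or.inl (hvb ▸ hua.tail hab)
    · obtain ⟨c, hvc, hcb⟩ := hv.exists_parent hvb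
      exact ih (hD.parent_unique hcb hab ▸ hvc)

theorem Ancestor.exists_pathOfLength {V : Type*} {D : Digraph V} {v w : V} (h : Ancestor D v w) :
    ∃ k, PathOfLength D k v w := by
  induction h with
  | refl => exact ⟨0, .nil _⟩
  | tail _ hbc ih => obtain ⟨k, hk⟩ := ih; exact ⟨k + 1, hk.snoc hbc⟩

theorem PathOfLength.ancestor {V : Type*} {D : Digraph V} {k : ℕ} {v w : V}
    (h : PathOfLength D k v w) : Ancestor D v w := by
  induction h with
  | nil v => exact .refl v
  | snoc _ hvw ih => exact Relation.ReflTransGen.tail ih hvw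

theorem pathOfLength_distance {V : Type*} {D : Digraph V} {v w : V} (h : Ancestor D v w) :
    PathOfLength D (distance D v w) v w :=
  Nat.sInf_mem (s := {k | PathOfLength D k v w}) h.exists_pathOfLength

/-- The last edge of a shortest walk from the root must leave the unique parent, so removing it
gives a shorter walk to that parent. -/
theorem IsHierarchical.distance_parent_lt {V : Type*} {D : Digraph V} {root : V}
    (hD : IsHierarchical D root) {v w : V} (hvw : Parent D v w) (hw : Ancestor D root w) :
    distance D root v < distance D root w := by
  have h := pathOfLength_distance hw
  revert h
  generalize distance D root w = k
  intro h
  cases h with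
  | nil => exact absurd hvw (hD.1 v)
  | @snoc k u v' w hu huv =>
    rw [hD.parent_unique hvw huv]
    exact Nat.lt_succ_of_le (Nat.sInf_le hu)

theorem IsHierarchical.distance_le {V : Type*} {D : Digraph V} {root : V}
    (hD : IsHierarchical D root) {v w : V} (hv : Ancestor D root v) (hvw : Ancestor D v w) :
    distance D root v ≤ distance D root w := by
  induction hvw with
  | refl => exact le_rfl
  | tail hb hbc ih =>
    exact ih.trans (hD.distance_parent_lt hbc ((hv.trans hb).trans (.single hbc))).le

theorem IsHierarchical.distance_lt {V : Type*} {D : Digraph V} {root : V}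
    (hD : IsHierarchical D root) {v w : V} (hv : Ancestor D root v) (hvw : Ancestor D v w)
    (hne : v ≠ w) : distance D root v < distance D root w := by
  obtain ⟨u, hvu, huw⟩ := hvw.exists_parent hne
  exact (hD.distance_le hv hvu).trans_lt (hD.distance_parent_lt huw (hv.trans hvw))

namespace StructuredSystem

variable {n m p : ℕ} (S : StructuredSystem n m p)

theorem scc_surjective (N : S.SCC) : ∃ x, S.scc x = N := Quotient.exists_rep N

theorem scc_eq_iff {x y : Fin n} :
    S.scc x = S.scc y ↔ Ancestor S.stateDigraph x y ∧ Ancestor S.stateDigraph y x :=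
  Quotient.eq (r := S.sccSetoid)

theorem ancestor_scc_of_ancestor {x y : Fin n} (h : Ancestor S.stateDigraph x y) :
    Ancestor S.sccDAG (S.scc x) (S.scc y) := by
  induction h with
  | refl => exact .refl _
  | @tail b c _ hbc ih =>
    by_cases hne : S.scc b = S.scc c
    · exact hne ▸ ih
    · exact Relation.ReflTransGen.tail ih ⟨hne, b, c, rfl, rfl, hbc⟩

theorem ancestor_of_ancestor_scc {N M : S.SCC} (h : Ancestor S.sccDAG N M) :
    ∀ x y, S.scc x = N → S.scc y = M → Ancestor S.stateDigraph x y := by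
  induction h with
  | refl => exact fun x y hx hy => (S.scc_eq_iff.1 (hx.trans hy.symm)).1
  | tail _ hbc ih =>
    rintro x y hx hy
    obtain ⟨-, a, b, ha, hb, hab⟩ := hbc
    exact ((ih x a hx ha).tail hab).trans (S.scc_eq_iff.1 (hb.trans hy.symm)).1

theorem ancestor_scc_iff {x y : Fin n} :
    Ancestor S.sccDAG (S.scc x) (S.scc y) ↔ Ancestor S.stateDigraph x y :=
  ⟨fun h => S.ancestor_of_ancestor_scc h x y rfl rfl, S.ancestor_scc_of_ancestor⟩

theorem ancestor_antisymm {N M : S.SCC} (h : Ancestor S.sccDAG N M) (h' : Ancestor S.sccDAG M N) :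
    N = M := by
  obtain ⟨x, rfl⟩ := S.scc_surjective N
  obtain ⟨y, rfl⟩ := S.scc_surjective M
  exact S.scc_eq_iff.2 ⟨S.ancestor_scc_iff.1 h, S.ancestor_scc_iff.1 h'⟩

/-- A nonempty set of components has a member with no other ancestor in the set. -/
theorem exists_topmost (s : Set S.SCC) {M : S.SCC} (hM : M ∈ s) :
    ∃ M₀ ∈ s, Ancestor S.sccDAG M₀ M ∧ ∀ M' ∈ s, Ancestor S.sccDAG M' M₀ → M' = M₀ := by
  let _ : PartialOrder S.SCC :=
    { le := Ancestor S.sccDAG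
      le_refl := Ancestor.refl
      le_trans := fun _ _ _ => Ancestor.trans
      le_antisymm := fun _ _ => S.ancestor_antisymm }
  obtain ⟨M₀, hle, hmin⟩ := (Set.toFinite s).exists_le_minimal hM
  exact ⟨M₀, hmin.prop, hle, fun M' hM' h => hmin.eq_of_le hM' h⟩

/-- Following ancestors upwards ends, by finiteness and antisymmetry, at a node without a parent,
and only the root has none. -/
theorem ancestor_root {root : S.SCC} (hroot : IsHierarchical S.sccDAG root) (N : S.SCC) :
    Ancestor S.sccDAG root N := by
  obtain ⟨M, -, hMN, hM⟩ := S.exists_topmost Set.univ (Set.mem_univ N)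
  by_cases h : M = root
  · exact h ▸ hMN
  · obtain ⟨v, hv, -⟩ := hroot.2 M h
    exact absurd (hM v trivial (.single hv)) hv.1

/-! ### Coverings by feedback edges -/

theorem mem_coveringEdges {N : S.SCC} {e : FeedbackEdge m p} :
    e ∈ S.coveringEdges N ↔ e.1 ∈ S.outputSet N ∧ e.2 ∈ S.inputSet N := by
  simp [coveringEdges]

theorem mem_coveringEdges_iff {N : S.SCC} {e : FeedbackEdge m p} :
    e ∈ S.coveringEdges N ↔ (∃ y, Ancestor S.sccDAG N (S.scc y) ∧ S.C e.1 y = true) ∧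
      ∃ x, Ancestor S.sccDAG (S.scc x) N ∧ S.B x e.2 = true :=
  S.mem_coveringEdges

/-- The input lies above `N`, hence above `M`; the output lies below `X`, hence below `M`. This
convexity makes the uncovered part of a tree with covered root closed under descendants. -/
theorem mem_coveringEdges_of_between {N M X : S.SCC} {e : FeedbackEdge m p}
    (hNM : Ancestor S.sccDAG N M) (hMX : Ancestor S.sccDAG M X)
    (hN : e ∈ S.coveringEdges N) (hX : e ∈ S.coveringEdges X) : e ∈ S.coveringEdges M := by
  rw [mem_coveringEdges_iff] at *
  obtain ⟨-, x, hx, hBx⟩ := hN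
  obtain ⟨⟨y, hy, hCy⟩, -⟩ := hX
  exact ⟨⟨y, hMX.trans hy, hCy⟩, x, hx.trans hNM, hBx⟩

/-- Every node of the subtree of `N` is covered by an edge of `H`. -/
def CoversTree (H : Finset (FeedbackEdge m p)) (N : S.SCC) : Prop :=
  ∀ M ∈ S.tree N, ∃ e ∈ H, e ∈ S.coveringEdges M

/-- The edges `Z` and the cost `c` solve the covering problem for the subtree of `N`. -/
structure SolvesTree (P : CostMatrix m p) (N : S.SCC)
    (Zc : Finset (FeedbackEdge m p) × ℝ≥0∞) : Prop where
  cost_eq : Zc.2 = edgeCost P Zc.1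
  covers : S.CoversTree Zc.1 N
  exists_covered : ∀ e ∈ Zc.1, ∃ M ∈ S.tree N, e ∈ S.coveringEdges M
  le_cost : ∀ H, S.CoversTree H N → Zc.2 ≤ edgeCost P H

theorem mem_forestRoots {N M : S.SCC} {e : FeedbackEdge m p} :
    M ∈ S.forestRoots N e ↔
      M ∈ S.forest N e ∧ ∀ M' ∈ S.forest N e, ¬ Parent S.sccDAG M' M := by
  simp [forestRoots]

theorem exists_forestRoot {N M : S.SCC} {e : FeedbackEdge m p} (hM : M ∈ S.forest N e) :
    ∃ M₀ ∈ S.forestRoots N e, M ∈ S.tree M₀ := by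
  obtain ⟨M₀, hM₀, hle, hmin⟩ := S.exists_topmost _ hM
  exact ⟨M₀, S.mem_forestRoots.2 ⟨hM₀, fun M' hM' h => h.1 (hmin M' hM' (.single h))⟩, hle⟩

/-- The subtrees of which the forest is composed are disjoint. -/
theorem forestRoots_eq_of_mem_tree {root : S.SCC} (hroot : IsHierarchical S.sccDAG root)
    {N M₁ M₂ X : S.SCC} {e : FeedbackEdge m p} (he : e ∈ S.coveringEdges N)
    (h₁ : M₁ ∈ S.forestRoots N e) (h₂ : M₂ ∈ S.forestRoots N e)
    (hX₁ : X ∈ S.tree M₁) (hX₂ : X ∈ S.tree M₂) : M₁ = M₂ := by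
  wlog h : Ancestor S.sccDAG M₁ M₂ generalizing M₁ M₂
  · exact (this h₂ h₁ hX₂ hX₁ ((hroot.comparable hX₁ hX₂).resolve_left h)).symm
  by_contra hne
  obtain ⟨Q, hMQ, hQ⟩ := h.exists_parent hne
  rw [mem_forestRoots] at h₁ h₂
  have hNM₁ : Ancestor S.sccDAG N M₁ := h₁.1.1
  exact h₂.2 Q ⟨hNM₁.trans hMQ,
    fun heQ => h₁.1.2 (S.mem_coveringEdges_of_between hNM₁ hMQ he heQ)⟩ hQ

theorem edgeCost_biUnion_le {ι : Type*} (P : CostMatrix m p)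
    (s : Finset ι) (t : ι → Finset (FeedbackEdge m p)) :
    edgeCost P (s.biUnion t) ≤ ∑ i ∈ s, edgeCost P (t i) := by
  classical
  induction s using Finset.induction_on with
  | empty => simp [edgeCost]
  | insert a s ha ih =>
    rw [Finset.sum_insert ha, Finset.biUnion_insert]
    refine le_trans ?_ (add_le_add le_rfl ih)
    unfold edgeCost
    rw [← Finset.sum_union_inter]
    exact le_self_add

theorem forestRoots_descendant {N M : S.SCC} {e : FeedbackEdge m p} (he : e ∈ S.coveringEdges N)
    (hM : M ∈ S.forestRoots N e) : Ancestor S.sccDAG N M ∧ N ≠ M := by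
  rw [mem_forestRoots] at hM
  exact ⟨hM.1.1, fun h => hM.1.2 (h ▸ he)⟩

theorem not_mem_coveringEdges_of_forestRoot {N M X : S.SCC} {e : FeedbackEdge m p}
    (he : e ∈ S.coveringEdges N) (hM : M ∈ S.forestRoots N e) (hX : X ∈ S.tree M) :
    e ∉ S.coveringEdges X := by
  intro heX
  rw [mem_forestRoots] at hM
  exact hM.1.2 (S.mem_coveringEdges_of_between hM.1.1 hX he heX)

/-- The step of the algorithm never exceeds the cost of a covering. -/
theorem treeCost_le_of_coversTree (hC : ∀ j : Fin p, ∃! i : Fin n, S.C j i = true)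
    {root : S.SCC} (hroot : IsHierarchical S.sccDAG root) (P : CostMatrix m p) (T : S.Table)
    {N : S.SCC} {e : FeedbackEdge m p} (he : e ∈ S.coveringEdges N)
    (hT : ∀ M ∈ S.forestRoots N e, S.SolvesTree P M (T M))
    {H : Finset (FeedbackEdge m p)} (hH : S.CoversTree H N) (heH : e ∈ H) :
    S.treeCost P T N e ≤ edgeCost P H := by
  classical
  -- The share of `H` that serves the subtree rooted at `M`.
  let HM : S.SCC → Finset (FeedbackEdge m p) :=
    fun M => H.filter fun h => ∃ X ∈ S.tree M, h ∈ S.coveringEdges X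
  -- An output senses a single state, and covering a node of a subtree puts that state in the
  -- subtree; so no edge belongs to two shares.
  have hdisj : (S.forestRoots N e : Set S.SCC).PairwiseDisjoint HM := by
    intro M₁ h₁ M₂ h₂ hne
    refine Finset.disjoint_left.2 fun h hh₁ hh₂ => hne ?_
    obtain ⟨X₁, hX₁, hc₁⟩ := (Finset.mem_filter.1 hh₁).2
    obtain ⟨X₂, hX₂, hc₂⟩ := (Finset.mem_filter.1 hh₂).2
    obtain ⟨⟨y₁, hy₁, hCy₁⟩, -⟩ := S.mem_coveringEdges_iff.1 hc₁
    obtain ⟨⟨y₂, hy₂, hCy₂⟩, -⟩ := S.mem_coveringEdges_iff.1 hc₂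
    obtain rfl := (hC h.1).unique hCy₁ hCy₂
    exact S.forestRoots_eq_of_mem_tree hroot he h₁ h₂
      (Ancestor.trans hX₁ hy₁ : Ancestor S.sccDAG M₁ (S.scc y₁))
      (Ancestor.trans hX₂ hy₂ : Ancestor S.sccDAG M₂ (S.scc y₁))
  have hnot : e ∉ (S.forestRoots N e).biUnion HM := by
    intro h
    obtain ⟨M, hM, heM⟩ := Finset.mem_biUnion.1 h
    obtain ⟨X, hX, hc⟩ := (Finset.mem_filter.1 heM).2
    exact S.not_mem_coveringEdges_of_forestRoot he hM hX hc
  have hsub : insert e ((S.forestRoots N e).biUnion HM) ⊆ H := by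
    refine Finset.insert_subset heH (Finset.biUnion_subset.2 fun M _ => Finset.filter_subset _ _)
  calc S.treeCost P T N e
      ≤ P e.2 e.1 + ∑ M ∈ S.forestRoots N e, edgeCost P (T M).1 :=
        add_le_add le_rfl (edgeCost_biUnion_le P _ _)
    _ ≤ P e.2 e.1 + ∑ M ∈ S.forestRoots N e, edgeCost P (HM M) := by
        refine add_le_add le_rfl (Finset.sum_le_sum fun M hM => ?_)
        rw [← (hT M hM).cost_eq]
        refine (hT M hM).le_cost _ fun X hX => ?_
        obtain ⟨h, hh, hc⟩ := hH X (Ancestor.trans (S.forestRoots_descendant he hM).1 hX)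
        exact ⟨h, Finset.mem_filter.2 ⟨hh, X, hX, hc⟩, hc⟩
    _ = edgeCost P (insert e ((S.forestRoots N e).biUnion HM)) := by
        unfold edgeCost
        rw [Finset.sum_insert hnot, Finset.sum_biUnion hdisj]
    _ ≤ edgeCost P H := Finset.sum_le_sum_of_subset hsub

/-- This is the Bellman step: any covering of the tree must contain some edge covering `N`, and the
lower bound for that edge dominates the minimum. -/
theorem solvesTree_of_minimizer (hC : ∀ j : Fin p, ∃! i : Fin n, S.C j i = true)
    {root : S.SCC} (hroot : IsHierarchical S.sccDAG root) (P : CostMatrix m p) (T : S.Table)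
    {N : S.SCC} (hT : ∀ M, Ancestor S.sccDAG N M → N ≠ M → S.SolvesTree P M (T M))
    (h : (S.coveringEdges N).Nonempty)
    {e : FeedbackEdge m p} (he : e ∈ S.minimizers P T N h) :
    S.SolvesTree P N (insert e (S.forestEdges T N e),
      (S.coveringEdges N).inf' h (S.treeCost P T N)) := by
  classical
  simp only [minimizers, Finset.mem_filter] at he
  obtain ⟨heN, hmin⟩ := he
  have hT' : ∀ e ∈ S.coveringEdges N, ∀ M ∈ S.forestRoots N e, S.SolvesTree P M (T M) :=
    fun e he M hM => hT M (S.forestRoots_descendant he hM).1 (S.forestRoots_descendant he hM).2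
  have hcov : ∀ e' ∈ S.forestEdges T N e, ∃ M ∈ S.forestRoots N e, ∃ X ∈ S.tree M,
      e' ∈ S.coveringEdges X := by
    intro e' he'
    obtain ⟨M, hM, he'M⟩ := Finset.mem_biUnion.1 he'
    exact ⟨M, hM, (hT' e heN M hM).exists_covered e' he'M⟩
  constructor
  -- If `e` were already in the forest solution, its cost would be counted twice; but each edge
  -- there covers a node that `e` misses.
  · have hnot : e ∉ S.forestEdges T N e := by
      intro hmem
      obtain ⟨M, hM, X, hX, hc⟩ := hcov e hmem
      exact S.not_mem_coveringEdges_of_forestRoot heN hM hX hc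
    show (S.coveringEdges N).inf' h (S.treeCost P T N) = _
    rw [hmin, edgeCost, Finset.sum_insert hnot]
    rfl
  · intro X hX
    by_cases heX : e ∈ S.coveringEdges X
    · exact ⟨e, Finset.mem_insert_self _ _, heX⟩
    · obtain ⟨M, hM, hXM⟩ := S.exists_forestRoot (N := N) (M := X) (e := e) ⟨hX, heX⟩
      obtain ⟨e', he', hc⟩ := (hT' e heN M hM).covers X hXM
      exact ⟨e', Finset.mem_insert_of_mem (Finset.mem_biUnion.2 ⟨M, hM, he'⟩), hc⟩
  · intro e' he'
    rcases Finset.mem_insert.1 he' with rfl | he'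
    · exact ⟨N, Ancestor.refl N, heN⟩
    · obtain ⟨M, hM, X, hX, hc⟩ := hcov e' he'
      exact ⟨X, Ancestor.trans (S.forestRoots_descendant heN hM).1 hX, hc⟩
  · intro H hH
    obtain ⟨e', he'H, he'N⟩ := hH N (Ancestor.refl N)
    exact (Finset.inf'_le _ he'N).trans
      (S.treeCost_le_of_coversTree hC hroot P T he'N (hT' e' he'N) hH he'H)

/-! ### Correctness of the dynamic programming algorithm -/

theorem visit_eq_some (hC : ∀ j : Fin p, ∃! i : Fin n, S.C j i = true)
    {root : S.SCC} (hroot : IsHierarchical S.sccDAG root) (P : CostMatrix m p) (tie : S.TieBreak)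
    {T T' : S.Table} {N : S.SCC}
    (hT : ∀ M, Ancestor S.sccDAG N M → N ≠ M → S.SolvesTree P M (T M))
    (h : S.visit P tie T N = some T') :
    S.SolvesTree P N (T' N) ∧ ∀ M, M ≠ N → T' M = T M := by
  classical
  unfold visit at h
  split_ifs at h with hne
  obtain rfl := Option.some_injective _ h
  refine ⟨?_, fun M hM => Function.update_of_ne hM _ _⟩
  rw [Function.update_self]
  exact S.solvesTree_of_minimizer hC hroot P T hT hne (tie N _ _).2

/-- `G` collects the nodes solved beforehand. As all strict descendants of the listed nodes lie in
`G`, the order of the list is irrelevant. -/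
theorem foldlM_visit (hC : ∀ j : Fin p, ∃! i : Fin n, S.C j i = true)
    {root : S.SCC} (hroot : IsHierarchical S.sccDAG root) (P : CostMatrix m p) (tie : S.TieBreak)
    (l : List S.SCC) (G : Set S.SCC)
    (hl : ∀ N ∈ l, ∀ M, Ancestor S.sccDAG N M → N ≠ M → M ∈ G)
    {T T' : S.Table} (hT : ∀ M ∈ G, S.SolvesTree P M (T M))
    (h : l.foldlM (S.visit P tie) T = some T') :
    ∀ M, M ∈ G ∨ M ∈ l → S.SolvesTree P M (T' M) := by
  induction l generalizing G T with
  | nil =>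
    obtain rfl : T = T' := by simpa using h
    rintro M (hM | hM)
    · exact hT M hM
    · simp at hM
  | cons N l ih =>
    rw [List.foldlM_cons] at h
    obtain ⟨T₁, hT₁, h⟩ := Option.bind_eq_some_iff.1 h
    obtain ⟨hN, hother⟩ := S.visit_eq_some hC hroot P tie
      (fun M hNM hne => hT M (hl N (by simp) M hNM hne)) hT₁
    have hG : ∀ M ∈ insert N G, S.SolvesTree P M (T₁ M) := by
      intro M hM
      by_cases hMN : M = N
      · exact hMN ▸ hN
      · exact hother M hMN ▸ hT M (Set.mem_of_mem_insert_of_ne hM hMN)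
    intro M hM
    refine ih (insert N G) (fun N' hN' M hNM hne =>
      Or.inr (hl N' (List.mem_cons_of_mem _ hN') M hNM hne)) hG h M ?_
    rcases hM with hM | hM
    · exact Or.inl (Or.inr hM)
    · rcases List.mem_cons.1 hM with rfl | hM
      · exact Or.inl (Or.inl rfl)
      · exact Or.inr hM

/-- The invariant is that all nodes at distance at least `k` are solved when the layers at smaller
distance remain. -/
theorem foldlM_layers (hC : ∀ j : Fin p, ∃! i : Fin n, S.C j i = true)
    {root : S.SCC} (hroot : IsHierarchical S.sccDAG root) (P : CostMatrix m p) (tie : S.TieBreak)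
    {enum : ℕ → List S.SCC} (henum : S.IsLayerEnumeration root enum) (k : ℕ)
    {T T' : S.Table} (hT : ∀ M, k ≤ distance S.sccDAG root M → S.SolvesTree P M (T M))
    (h : ((List.range k).reverse.flatMap fun f => enum (f + 1)).foldlM (S.visit P tie) T
      = some T') :
    ∀ M, S.SolvesTree P M (T' M) := by
  induction k generalizing T with
  | zero =>
    obtain rfl : T = T' := by simpa using h
    exact fun M => hT M (Nat.zero_le _)
  | succ k ih =>
    rw [List.range_succ, List.reverse_append, List.reverse_singleton, List.flatMap_append,
      List.flatMap_singleton, List.foldlM_append] at h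
    obtain ⟨T₁, hT₁, h⟩ := Option.bind_eq_some_iff.1 h
    have hmem : ∀ N, N ∈ enum (k + 1) ↔ distance S.sccDAG root N = k := by
      intro N
      rw [(henum (k + 1)).2 N]
      exact ⟨fun hN => by have := hN.2; omega, fun hN => ⟨S.ancestor_root hroot N, by omega⟩⟩
    refine ih (fun M hM => ?_) h
    refine S.foldlM_visit hC hroot P tie (enum (k + 1)) {M | k + 1 ≤ distance S.sccDAG root M}
      (fun N hN M hNM hne => ?_) hT hT₁ M ?_
    · have := hroot.distance_lt (S.ancestor_root hroot N) hNM hne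
      rw [(hmem N).1 hN] at this
      exact this
    · rcases hM.eq_or_lt with hM | hM
      · exact Or.inr ((hmem M).2 hM.symm)
      · exact Or.inl hM

theorem hierarchicalAlgorithm_solvesTree (hC : ∀ j : Fin p, ∃! i : Fin n, S.C j i = true)
    {root : S.SCC} (hroot : IsHierarchical S.sccDAG root) (P : CostMatrix m p) (tie : S.TieBreak)
    {enum : ℕ → List S.SCC} (henum : S.IsLayerEnumeration root enum)
    {Zc : Finset (FeedbackEdge m p) × ℝ≥0∞}
    (h : S.hierarchicalAlgorithm P root enum tie = some Zc) : S.SolvesTree P root Zc := by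
  obtain ⟨T, hT, rfl⟩ := Option.map_eq_some_iff.1 h
  refine S.foldlM_layers hC hroot P tie henum _ (fun M hM => ?_) hT root
  -- No node is this far from the root, so the invariant holds vacuously for the initial table.
  have hlt : distance S.sccDAG root M + 1 ≤ numLayers S.sccDAG root := by
    refine le_trans ?_ (Finset.le_sup (Finset.mem_univ M))
    rw [if_pos (S.ancestor_root hroot M)]
  omega

theorem exists_hierarchicalAlgorithm_eq_some (P : CostMatrix m p) (tie : S.TieBreak)
    (root : S.SCC) (enum : ℕ → List S.SCC) (hcov : ∀ N, (S.coveringEdges N).Nonempty) :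
    ∃ Zc, S.hierarchicalAlgorithm P root enum tie = some Zc := by
  have hfold : ∀ (l : List S.SCC) (T : S.Table), ∃ T', l.foldlM (S.visit P tie) T = some T' := by
    intro l
    induction l with
    | nil => exact fun T => ⟨T, rfl⟩
    | cons N l ih =>
      intro T
      obtain ⟨T₁, hT₁⟩ : ∃ T₁, S.visit P tie T N = some T₁ := by
        simp only [visit, dif_pos (hcov N)]
        exact ⟨_, rfl⟩
      obtain ⟨T', hT'⟩ := ih T₁
      exact ⟨T', by rw [List.foldlM_cons, hT₁]; exact hT'⟩
  obtain ⟨T, hT⟩ := hfold (S.visitOrder root enum) fun _ => (∅, 0)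
  exact ⟨T root, by rw [hierarchicalAlgorithm, hT]; rfl⟩

theorem edgeCost_eq_matrixCost (P : CostMatrix m p) (H : Finset (FeedbackEdge m p))
    (K : StructuredMatrix m p) (hK : ∀ e, e ∈ H ↔ K e.2 e.1 = true) :
    edgeCost P H = matrixCost P K := by
  classical
  have : H = Finset.univ.filter fun e : FeedbackEdge m p => K e.2 e.1 = true := by
    ext e; simp [hK]
  rw [this, edgeCost, matrixCost, Finset.sum_filter, Fintype.sum_prod_type, Finset.sum_comm]

end StructuredSystem
namespace StructuredSystem

variable {n m p : ℕ} (S : StructuredSystem n m p)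

/-! ### Fixed modes of a component without a covering edge -/

theorem exists_edge_of_mul_ne_zero {S : StructuredSystem n m p} {K : StructuredMatrix m p}
    {B : Matrix (Fin n) (Fin m) ℝ} {C : Matrix (Fin p) (Fin n) ℝ} {K' : Matrix (Fin m) (Fin p) ℝ}
    (hB : Realizes B S.B) (hC : Realizes C S.C) (hK : Realizes K' K) {i j : Fin n}
    (h : (B * K' * C) i j ≠ 0) : ∃ k l, S.B i k = true ∧ K k l = true ∧ S.C l j = true := by
  rw [Matrix.mul_apply] at h
  obtain ⟨l, -, hl⟩ := Finset.exists_ne_zero_of_sum_ne_zero h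
  have hBK := left_ne_zero_of_mul hl
  rw [Matrix.mul_apply] at hBK
  obtain ⟨k, -, hk⟩ := Finset.exists_ne_zero_of_sum_ne_zero hBK
  exact ⟨k, l, by_contra fun h => left_ne_zero_of_mul hk (hB _ _ (by simpa using h)),
    by_contra fun h => right_ne_zero_of_mul hk (hK _ _ (by simpa using h)),
    by_contra fun h => right_ne_zero_of_mul hl (hC _ _ (by simpa using h))⟩

/-- If the states are ranked such that no edge of the closed loop starts at a lower rank than it
ends, and the diagonal block of
rank one receives no feedback, then its eigenvalues are structurally fixed modes. -/
theorem not_noStructurallyFixedModes_of_rank (K : StructuredMatrix m p) (b : Fin n → ℕ)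
    {x : Fin n} (hx : b x = 1) (hA : ∀ i j, S.A i j = true → b i ≤ b j)
    (hK : ∀ i j k l, S.B i k = true → K k l = true → S.C l j = true →
      b i ≤ b j ∧ ¬(b i = 1 ∧ b j = 1)) :
    ¬ S.NoStructurallyFixedModes K := by
  classical
  rintro ⟨A, B, C, hAr, hBr, hCr, hfix⟩
  let A₁ : Matrix {i // b i = 1} {i // b i = 1} ℂ := (A.map (algebraMap ℝ ℂ)).toSquareBlock b 1
  obtain ⟨μ, hμ⟩ : ∃ μ, A₁.charpoly.IsRoot μ := by
    refine IsAlgClosed.exists_root _ ?_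
    rw [Matrix.charpoly_degree_eq_dim]
    have : 0 < Fintype.card {i // b i = 1} := Fintype.card_pos_iff.2 ⟨⟨x, hx⟩⟩
    exact_mod_cast this.ne'
  refine Set.eq_empty_iff_forall_notMem.1 hfix μ (Set.mem_iInter₂.2 fun K' hK' => ?_)
  set M := (A + B * K' * C).map (algebraMap ℝ ℂ) with hM
  rw [Matrix.mem_spectrum_iff_isRoot_charpoly, Polynomial.IsRoot.def, Matrix.eval_charpoly]
  have hzero : ∀ i j, b j < b i → M i j = 0 := by
    intro i j hij
    have h₁ : A i j = 0 := hAr _ _ (by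
      by_contra h
      exact absurd (hA i j (by simpa using h)) (by omega))
    have h₂ : (B * K' * C) i j = 0 := by
      by_contra h
      obtain ⟨k, l, hk, hkl, hl⟩ := exists_edge_of_mul_ne_zero hBr hCr hK' h
      exact absurd (hK i j k l hk hkl hl).1 (by omega)
    simp [hM, h₁, h₂]
  have htri : (Matrix.scalar (Fin n) μ - M).BlockTriangular b := by
    intro i j hij
    have hne : i ≠ j := fun h => by simp [h] at hij
    simp [hzero i j hij, Matrix.diagonal_apply_ne _ hne]
  rw [htri.det]
  refine Finset.prod_eq_zero (i := 1) (Finset.mem_image.2 ⟨x, Finset.mem_univ _, hx⟩) ?_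
  rw [Polynomial.IsRoot.def, Matrix.eval_charpoly] at hμ
  rw [← hμ]
  -- On the block of rank one the feedback term vanishes, so this diagonal block of `μ - M` is that
  -- of the open loop.
  congr 1
  ext i j
  have h₂ : (B * K' * C) i j = 0 := by
    by_contra h
    obtain ⟨k, l, hk, hkl, hl⟩ := exists_edge_of_mul_ne_zero hBr hCr hK' h
    exact (hK i j k l hk hkl hl).2 ⟨i.2, j.2⟩
  simp [hM, A₁, Matrix.toSquareBlock_def, h₂, Matrix.diagonal_apply, Subtype.ext_iff]

open scoped Classical in
/-- Two for the strict ancestors of `N`, one for `N`, zero for all other components. -/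
def ancestorRank (N : S.SCC) (i : Fin n) : ℕ :=
  if S.scc i = N then 1 else if Ancestor S.sccDAG (S.scc i) N then 2 else 0

open scoped Classical in
/-- Zero for the strict descendants of `N`, one for `N`, two for all other components. -/
def descendantRank (N : S.SCC) (i : Fin n) : ℕ :=
  if S.scc i = N then 1 else if Ancestor S.sccDAG N (S.scc i) then 0 else 2

theorem ancestor_scc_of_edge {i j : Fin n} (h : S.A i j = true) :
    Ancestor S.sccDAG (S.scc j) (S.scc i) :=
  S.ancestor_scc_of_ancestor (.single h)

theorem ancestorRank_le {N : S.SCC} {i j : Fin n} (h : S.A i j = true) :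
    S.ancestorRank N i ≤ S.ancestorRank N j := by
  have h := S.ancestor_scc_of_edge h
  unfold ancestorRank
  by_cases hi : S.scc i = N
  · have hj : Ancestor S.sccDAG (S.scc j) N := hi ▸ h
    simp only [hi, hj, if_true]
    split_ifs <;> omega
  · by_cases hi' : Ancestor S.sccDAG (S.scc i) N
    · have hj : S.scc j ≠ N := fun hj => hi (S.ancestor_antisymm hi' (hj ▸ h))
      simp [hi, hj, h.trans hi', hi']
    · simp [hi, hi']

theorem descendantRank_le {N : S.SCC} {i j : Fin n} (h : Ancestor S.sccDAG (S.scc j) (S.scc i)) :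
    S.descendantRank N i ≤ S.descendantRank N j := by
  unfold descendantRank
  by_cases hj : S.scc j = N
  · have hi : Ancestor S.sccDAG N (S.scc i) := hj ▸ h
    simp only [hj, hi, if_true]
    split_ifs <;> omega
  · by_cases hj' : Ancestor S.sccDAG N (S.scc j)
    · have hi : S.scc i ≠ N := fun hi => hj (S.ancestor_antisymm (hi ▸ h) hj')
      simp [hi, hj, hj', hj'.trans h]
    · simp only [hj, hj', if_false]
      split_ifs <;> omega

/-- If the closed loop has no structurally fixed modes for some feedback pattern, then every
component is covered by some feedback edge. -/
theorem coveringEdges_nonempty {K : StructuredMatrix m p} (hK : S.NoStructurallyFixedModes K)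
    (N : S.SCC) : (S.coveringEdges N).Nonempty := by
  obtain ⟨x, hx⟩ := S.scc_surjective N
  -- Without inputs above `N`, feedback only enters states of rank zero, the bottom of the order.
  obtain ⟨i, hi⟩ : (S.inputSet N).Nonempty := by
    by_contra hemp
    refine S.not_noStructurallyFixedModes_of_rank K (S.ancestorRank N) (x := x)
      (by simp [ancestorRank, hx]) (fun i j h => S.ancestorRank_le h) (fun i j k l hB _ _ => ?_) hK
    have hi : ¬ Ancestor S.sccDAG (S.scc i) N := fun h => hemp ⟨k, i, h, hB⟩
    have hi' : S.scc i ≠ N := fun h => hi (h ▸ Ancestor.refl _)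
    simp [ancestorRank, hi, hi']
  -- Dually, without outputs below `N`, feedback only leaves states of rank two, the top of the
  -- order.
  obtain ⟨j, hj⟩ : (S.outputSet N).Nonempty := by
    by_contra hemp
    refine S.not_noStructurallyFixedModes_of_rank K (S.descendantRank N) (x := x)
      (by simp [descendantRank, hx]) (fun i j h => S.descendantRank_le (S.ancestor_scc_of_edge h))
      (fun i j k l _ _ hC => ?_) hK
    have hj : ¬ Ancestor S.sccDAG N (S.scc j) := fun h => hemp ⟨l, j, h, hC⟩
    have hj' : S.scc j ≠ N := fun h => hj (h ▸ Ancestor.refl _)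
    simp only [descendantRank, hj, hj', if_false]
    split_ifs <;> omega
  exact ⟨(j, i), S.mem_coveringEdges.2 ⟨hj, hi⟩⟩

/-- In a hierarchical network, back edges avoid structurally fixed modes only if every component
is covered by one of them. -/
theorem exists_mem_coveringEdges_of_backEdges {root : S.SCC}
    (hroot : IsHierarchical S.sccDAG root) {K : StructuredMatrix m p}
    (hback : ∀ i j k l, S.B i k = true → K k l = true → S.C l j = true →
      Ancestor S.stateDigraph i j)
    (hK : S.NoStructurallyFixedModes K) (N : S.SCC) :
    ∃ e : FeedbackEdge m p, K e.2 e.1 = true ∧ e ∈ S.coveringEdges N := by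
  by_contra! hN
  obtain ⟨x, hx⟩ := S.scc_surjective N
  refine S.not_noStructurallyFixedModes_of_rank K (S.descendantRank N) (x := x)
    (by simp [descendantRank, hx]) (fun i j h => S.descendantRank_le (S.ancestor_scc_of_edge h))
    (fun i j k l hB hKkl hC => ?_) hK
  have hij := S.ancestor_scc_of_ancestor (hback i j k l hB hKkl hC)
  have hncov : ¬(Ancestor S.sccDAG N (S.scc j) ∧ Ancestor S.sccDAG (S.scc i) N) := fun h =>
    hN (l, k) hKkl (S.mem_coveringEdges_iff.2 ⟨⟨j, h.1, hC⟩, i, h.2, hB⟩)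
  by_cases hj : Ancestor S.sccDAG N (S.scc j)
  · have hiN : ¬ Ancestor S.sccDAG (S.scc i) N := fun h => hncov ⟨hj, h⟩
    -- Both `N` and the component of `i` are ancestors of that of `j`, hence comparable; this is
    -- where the tree structure enters. So the feedback enters a strict descendant of `N`, of rank
    -- zero.
    have hNi := (hroot.comparable hij hj).resolve_left hiN
    have hi' : S.scc i ≠ N := fun h => hiN (h ▸ Ancestor.refl _)
    simp [descendantRank, hi', hNi]
  · have hj' : S.scc j ≠ N := fun h => hj (h ▸ Ancestor.refl _)
    simp only [descendantRank, hj, hj', if_false]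
    split_ifs <;> omega

/-- No edge enters an input and none leaves an output, so only the ends of a path can be anything
but states. -/
theorem exists_state_of_ancestor_output {v : Node n m p} {j : Fin p}
    (h : Ancestor S.systemDigraph v (.output j)) :
    (∃ x, v = .state x ∧ ∃ y, Ancestor S.stateDigraph x y ∧ S.C j y = true) ∨
    (∃ i, v = .input i ∧ ∃ x y, S.B x i = true ∧ Ancestor S.stateDigraph x y ∧ S.C j y = true) ∨
      v = .output j := by
  induction h using Relation.ReflTransGen.head_induction_on with
  | refl => exact Or.inr (Or.inr rfl)
  | @head a c hac _ ih =>
    rcases ih with ⟨x, rfl, y, hxy, hy⟩ | ⟨i, rfl, -⟩ | rfl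
    · cases a with
      | state z => exact Or.inl ⟨z, rfl, y, Relation.ReflTransGen.head hac hxy, hy⟩
      | input i => exact Or.inr (Or.inl ⟨i, rfl, x, y, hac, hxy, hy⟩)
      | output k => exact hac.elim
    · cases a <;> exact hac.elim
    · cases a with
      | state z => exact Or.inl ⟨z, rfl, z, .refl z, hac⟩
      | input i => exact hac.elim
      | output k => exact hac.elim

theorem ancestor_states_of_ancestor (hS : S.IsDedicated) {i : Fin m} {j : Fin p} {x y : Fin n}
    (hx : S.B x i = true) (hy : S.C j y = true)
    (h : Ancestor S.systemDigraph (.input i) (.output j)) : Ancestor S.stateDigraph x y := by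
  rcases S.exists_state_of_ancestor_output h with ⟨x', hx', -⟩ | ⟨i', hi', x', y', hB, hxy, hC⟩ | h
  · cases hx'
  · cases hi'
    rwa [(hS.1 i).unique hx hB, (hS.2 j).unique hy hC]
  · cases h

end StructuredSystem

section LinearAlgebra

open Polynomial Matrix

/-! ### The derivative of the characteristic polynomial -/

variable {ι : Type*} [Fintype ι] [DecidableEq ι]

theorem derivative_det_eq_sum_updateRow {R : Type*} [CommRing R] (M : Matrix ι ι R[X]) :
    derivative M.det = ∑ i, (M.updateRow i fun j => derivative (M i j)).det := by
  simp only [← Matrix.det_transpose (M := M), ← Matrix.det_transpose (M := M.updateRow _ _)]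
  simp only [Matrix.det_apply, map_sum]
  rw [Finset.sum_comm]
  refine Finset.sum_congr rfl fun σ _ => ?_
  rw [← Finset.smul_sum]
  simp only [Matrix.transpose_apply]
  rw [Units.smul_def, Units.smul_def, derivative_smul, derivative_prod_finset]
  congr 1
  refine Finset.sum_congr rfl fun i _ => ?_
  rw [← Finset.mul_prod_erase _ _ (Finset.mem_univ i), mul_comm]
  simp only [Matrix.updateRow_self]
  congr 1
  exact Finset.prod_congr rfl fun j hj => by rw [Matrix.updateRow_ne (Finset.ne_of_mem_erase hj)]

/-- Each row of the characteristic matrix has a unit vector as derivative, so the product rule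
yields the diagonal cofactors. -/
theorem eval_derivative_charpoly {R : Type*} [CommRing R] (A : Matrix ι ι R) (μ : R) :
    A.charpoly.derivative.eval μ = (Matrix.scalar ι μ - A).adjugate.trace := by
  have hrow : ∀ i, (fun j => derivative (A.charmatrix i j)) = Pi.single i 1 := by
    intro i
    ext1 j
    by_cases h : j = i
    · subst h; simp [Matrix.charmatrix_apply_eq]
    · simp [Matrix.charmatrix_apply_ne _ _ _ (Ne.symm h), h]
  have hmap : (evalRingHom μ).mapMatrix A.charmatrix = Matrix.scalar ι μ - A := by
    ext i j
    by_cases h : i = j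
    · subst h; simp [Matrix.charmatrix_apply_eq]
    · simp [Matrix.charmatrix_apply_ne _ _ _ h, Matrix.diagonal_apply_ne _ h]
  rw [Matrix.charpoly, derivative_det_eq_sum_updateRow, eval_finsetSum, ← hmap,
    ← RingHom.map_adjugate, Matrix.trace]
  refine Finset.sum_congr rfl fun i _ => ?_
  rw [hrow, ← Matrix.adjugate_apply]
  simp

/-- An eigenvalue is a simple root of the characteristic polynomial if no left eigenvector is
orthogonal to a right eigenvector. -/
theorem eval_derivative_charpoly_ne_zero_of_dotProduct_ne_zero {K : Type*} [Field K]
    (A : Matrix ι ι K) (μ : K)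
    (h : ∀ u v : ι → K, u ≠ 0 → v ≠ 0 → u ᵥ* A = μ • u → A *ᵥ v = μ • v → u ⬝ᵥ v ≠ 0)
    (hroot : A.charpoly.IsRoot μ) : A.charpoly.derivative.eval μ ≠ 0 := by
  intro hder
  have hne : A.charpoly ≠ 0 := A.charpoly_monic.ne_zero
  have hmult : 1 < A.charpoly.rootMultiplicity μ :=
    (one_lt_rootMultiplicity_iff_isRoot hne).2 ⟨hroot, hder⟩
  have hdet : (A - μ • 1).det = 0 := by
    rw [IsRoot.def, Matrix.eval_charpoly] at hroot
    rw [← neg_sub, Matrix.det_neg, Matrix.smul_one_eq_diagonal, ← Matrix.scalar_apply, hroot,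
      mul_zero]
  obtain ⟨u, hu, huA⟩ := Matrix.exists_vecMul_eq_zero_iff.2 hdet
  have huA' : u ᵥ* A = μ • u := by
    rw [Matrix.vecMul_sub, Matrix.vecMul_smul, Matrix.vecMul_one, sub_eq_zero] at huA
    exact huA
  let g : Module.End K (ι → K) := Matrix.toLin' A
  let φ : (ι → K) →ₗ[K] K := dotProductBilin K K u
  have hfin : 1 < Module.finrank K (g.maxGenEigenspace μ) := by
    rw [LinearMap.finrank_maxGenEigenspace_eq, Matrix.charpoly_toLin']
    exact hmult
  -- A multiple root makes the generalized eigenspace at least two-dimensional, so the functional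
  -- given by `u` has a nonzero kernel vector in it.
  obtain ⟨v, hv, hv0, huv⟩ : ∃ v ∈ g.maxGenEigenspace μ, v ≠ 0 ∧ φ v = 0 := by
    by_contra! hcon
    have hinj : Function.Injective (φ.domRestrict (g.maxGenEigenspace μ)) := by
      rw [← LinearMap.ker_eq_bot, LinearMap.ker_eq_bot']
      intro v hv
      by_contra hv0
      exact hcon v v.2 (by simpa using hv0) hv
    have := LinearMap.finrank_le_finrank_of_injective hinj
    rw [Module.finrank_self] at this
    omega
  have hφ : ∀ k : ℕ, φ (((g - μ • 1) ^ k) v) = 0 := by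
    intro k
    cases k with
    | zero => simpa using huv
    | succ k =>
      rw [pow_succ', Module.End.mul_apply]
      generalize ((g - μ • 1) ^ k) v = w
      show u ⬝ᵥ (A *ᵥ w - μ • w) = 0
      rw [dotProduct_sub, Matrix.dotProduct_mulVec, huA', smul_dotProduct, dotProduct_smul,
        sub_self]
  have hex := (Module.End.mem_maxGenEigenspace g μ v).1 hv
  classical
  have hspec := Nat.find_spec hex
  -- The last nonzero vector in the chain generated by `v` is a true eigenvector, and `u`
  -- annihilates the whole chain.
  have hmin := fun k => Nat.find_min hex (m := k)
  generalize Nat.find hex = k at hspec hmin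
  cases k with
  | zero => exact hv0 (by simpa using hspec)
  | succ k =>
    refine h u (((g - μ • 1) ^ k) v) hu (hmin k (Nat.lt_succ_self k)) huA' ?_ (hφ k)
    rw [pow_succ'] at hspec
    exact sub_eq_zero.1 hspec

/-! ### The observability matrix -/

/-- The matrix with the rows `b`-th row of `A ^ k`, for `k < card ι`. -/
def obsMatrix {R : Type*} [CommRing R] (A : Matrix ι ι R) (b : ι) : Matrix ι ι R :=
  Matrix.of fun i j => (A ^ (Fintype.equivFin ι i).val) b j

theorem map_det_obsMatrix {R R' : Type*} [CommRing R] [CommRing R'] (φ : R →+* R')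
    (A : Matrix ι ι R) (b : ι) : φ (obsMatrix A b).det = (obsMatrix (A.map φ) b).det := by
  rw [RingHom.map_det]
  congr 1
  ext i j
  have h := map_pow φ.mapMatrix A (Fintype.equivFin ι i).val
  exact congrFun (congrFun h b) j

theorem pow_mulVec_of_eigenvector {R : Type*} [CommRing R] {A : Matrix ι ι R} {μ : R}
    {v : ι → R} (h : A *ᵥ v = μ • v) (k : ℕ) : (A ^ k) *ᵥ v = μ ^ k • v := by
  induction k with
  | zero => simp
  | succ k ih => rw [pow_succ, ← Matrix.mulVec_mulVec, h, Matrix.mulVec_smul, ih, smul_smul,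
      pow_succ']

/-- The eigenvector test for observability, easy direction. -/
theorem eq_zero_of_det_obsMatrix_ne_zero {K : Type*} [Field K] {A : Matrix ι ι K} {b : ι}
    (hdet : (obsMatrix A b).det ≠ 0) {μ : K} {v : ι → K} (hv : A *ᵥ v = μ • v) (hb : v b = 0) :
    v = 0 := by
  refine Matrix.eq_zero_of_mulVec_eq_zero hdet ?_
  ext i
  show ((A ^ _) *ᵥ v) b = 0
  rw [pow_mulVec_of_eigenvector hv]
  simp [hb]

/-- The eigenvector test for observability. -/
theorem det_obsMatrix_ne_zero {K : Type*} [Field K] [IsAlgClosed K] {A : Matrix ι ι K} {b : ι}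
    (h : ∀ (μ : K) (v : ι → K), A *ᵥ v = μ • v → v b = 0 → v = 0) :
    (obsMatrix A b).det ≠ 0 := by
  intro hdet
  obtain ⟨u, hu, hAu⟩ := Matrix.exists_mulVec_eq_zero_iff.2 hdet
  have hlow : ∀ k < Fintype.card ι, ((A ^ k) *ᵥ u) b = 0 := by
    intro k hk
    have := congrFun hAu ((Fintype.equivFin ι).symm ⟨k, hk⟩)
    simpa [obsMatrix, Matrix.mulVec, dotProduct] using this
  -- Cayley–Hamilton reduces every power to the powers below the dimension.
  have hall : ∀ k, ((A ^ k) *ᵥ u) b = 0 := by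
    intro k
    rw [Matrix.pow_eq_aeval_mod_charpoly, aeval_eq_sum_range, Matrix.sum_mulVec,
      Finset.sum_apply]
    refine Finset.sum_eq_zero fun i hi => ?_
    rw [Matrix.smul_mulVec, Pi.smul_apply]
    by_cases hcard : i < Fintype.card ι
    · rw [hlow i hcard, smul_zero]
    · have hdeg : (X ^ k %ₘ A.charpoly).degree < Fintype.card ι := by
        have : Nontrivial K := inferInstance
        rw [← A.charpoly_degree_eq_dim]
        exact degree_modByMonic_lt _ A.charpoly_monic
      rw [coeff_eq_zero_of_degree_lt
        (hdeg.trans_le (by exact_mod_cast not_lt.1 hcard)), zero_smul]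
  -- The unobservable subspace is invariant and contains `u`, so it contains an eigenvector.
  let U : Submodule K (ι → K) :=
    { carrier := {v | ∀ k, ((A ^ k) *ᵥ v) b = 0}
      add_mem' := fun hv hw k => by simp [Matrix.mulVec_add, hv k, hw k]
      zero_mem' := fun k => by simp
      smul_mem' := fun c v hv k => by simp [Matrix.mulVec_smul, hv k] }
  have hU : ∀ v ∈ U, Matrix.toLin' A v ∈ U := by
    intro v hv k
    rw [Matrix.toLin'_apply, Matrix.mulVec_mulVec, ← pow_succ]
    exact hv (k + 1)
  have : Nontrivial U := ⟨⟨⟨u, hall⟩, 0, fun h => hu (congrArg Subtype.val h)⟩⟩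
  obtain ⟨μ, hμ⟩ := Module.End.exists_eigenvalue ((Matrix.toLin' A).restrict hU)
  obtain ⟨v, hv⟩ := hμ.exists_hasEigenvector
  have hAv := congrArg Subtype.val hv.apply_eq_smul
  exact hv.2 (Subtype.ext (h μ v hAv (by simpa using v.2 0)))

end LinearAlgebra

section Permutations

open Matrix

variable {ι : Type*} [Fintype ι]

/-! ### Weighted cycles -/

/-- On a finite type the forward powers of `f` already exhaust the cycle. -/
theorem sameCycle_induction (f : Equiv.Perm ι) (Z : ι → Prop) {j : ι} (hj : Z j)
    (hZ : ∀ x, f.SameCycle j x → Z x → Z (f x)) : ∀ x, f.SameCycle j x → Z x := by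
  have key : ∀ k : ℕ, Z ((f ^ k) j) := by
    intro k
    induction k with
    | zero => exact hj
    | succ k ih =>
      rw [pow_succ', Equiv.Perm.mul_apply]
      exact hZ _ ⟨k, by simp⟩ ih
  intro x hx
  obtain ⟨k, -, rfl⟩ := hx.exists_pow_eq'
  exact key k

theorem eq_zero_on_cycle (f : Equiv.Perm ι) {β : ℝ} (hβ : 0 < β) {j : ι} {μ : ℂ} {v : ι → ℂ}
    (hv : ∀ x, f.SameCycle j x → β * v (f x) = μ * v x) (hj : v j = 0) :
    ∀ x, f.SameCycle j x → v x = 0 := by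
  refine sameCycle_induction f _ hj fun x hx h0 => ?_
  have := hv x hx
  rw [h0, mul_zero] at this
  exact (mul_eq_zero.1 this).resolve_left (by exact_mod_cast hβ.ne')

/-- Summing absolute values over the cycle gives the same sum on both sides, because `f` permutes
the cycle. -/
theorem norm_eq_of_cycle (f : Equiv.Perm ι) {β : ℝ} (hβ : 0 < β) {j : ι} {μ : ℂ} {v : ι → ℂ}
    (hv : ∀ x, f.SameCycle j x → β * v (f x) = μ * v x) (hj : v j ≠ 0) : ‖μ‖ = β := by
  classical
  set s := Finset.univ.filter fun x => f.SameCycle j x with hs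
  have hperm : ∑ x ∈ s, ‖v (f x)‖ = ∑ x ∈ s, ‖v x‖ := by
    refine Finset.sum_bij (fun x _ => f x) (fun x hx => ?_) (fun x _ y _ h => f.injective h)
      (fun y hy => ⟨f.symm y, ?_, by simp⟩) fun x _ => rfl
    · simpa [hs] using hx
    · have hy : f.SameCycle j y := by simpa [hs] using hy
      have : f.SameCycle j (f (f.symm y)) := by simpa using hy
      simpa [hs] using Equiv.Perm.sameCycle_apply_right.1 this
  have hmul : β * ∑ x ∈ s, ‖v (f x)‖ = ‖μ‖ * ∑ x ∈ s, ‖v x‖ := by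
    rw [Finset.mul_sum, Finset.mul_sum]
    refine Finset.sum_congr rfl fun x hx => ?_
    have := congrArg norm (hv x (by simpa [hs] using hx))
    rwa [norm_mul, norm_mul, Complex.norm_real, Real.norm_of_nonneg hβ.le] at this
  have hpos : 0 < ∑ x ∈ s, ‖v x‖ :=
    Finset.sum_pos' (fun _ _ => norm_nonneg _)
      ⟨j, by simpa [hs] using Equiv.Perm.SameCycle.refl f j, norm_pos_iff.2 hj⟩
  rw [hperm] at hmul
  exact (mul_right_cancel₀ hpos.ne' hmul).symm

open scoped Classical in
/-- A weight on the cycles of `f` which tells different cycles apart. -/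
def cycleWeight (f : Equiv.Perm ι) (x : ι) : ℝ :=
  (Fintype.equivFin (Quotient (Equiv.Perm.SameCycle.setoid f)) (Quotient.mk _ x)).val + 1

theorem cycleWeight_pos (f : Equiv.Perm ι) (x : ι) : 0 < cycleWeight f x := by
  unfold cycleWeight; positivity

theorem cycleWeight_eq_iff (f : Equiv.Perm ι) {x y : ι} :
    cycleWeight f x = cycleWeight f y ↔ f.SameCycle x y := by
  unfold cycleWeight
  rw [add_left_inj, Nat.cast_inj, Fin.val_inj, EmbeddingLike.apply_eq_iff_eq]
  exact Quotient.eq (r := Equiv.Perm.SameCycle.setoid f)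

variable [DecidableEq ι]

/-- From `j` the zero travels forward to `i` and backward to `f i`, since the source acts only
between these two; the equation at `i` then leaves `t = 0`. -/
theorem eq_zero_of_cycle_source (f : Equiv.Perm ι) {β : ℝ} (hβ : 0 < β) {i j : ι} {μ t : ℂ}
    (hμ : μ ≠ 0) {v : ι → ℂ} (hi : f.SameCycle j i)
    (hv : ∀ x, f.SameCycle j x → β * v (f x) - μ * v x = if x = i then t else 0)
    (hj : v j = 0) : t = 0 := by
  have hβ' : (β : ℂ) ≠ 0 := by exact_mod_cast hβ.ne'
  have hvi : v i = 0 := by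
    by_contra hvi
    refine hvi (sameCycle_induction f (fun x => v x = 0) hj (fun x hx h0 => ?_) i hi)
    have := hv x hx
    rw [if_neg (fun h : x = i => hvi (h ▸ h0)), h0, mul_zero, sub_zero] at this
    exact (mul_eq_zero.1 this).resolve_left hβ'
  have hvfi : v (f i) = 0 := by
    by_contra hvi
    refine hvi (sameCycle_induction f⁻¹ (fun x => v x = 0) hj (fun x hx h0 => ?_) (f i)
      (Equiv.Perm.sameCycle_inv.2 (Equiv.Perm.sameCycle_apply_right.2 hi)))
    have := hv (f.symm x)
      (Equiv.Perm.sameCycle_symm_apply_right.2 (Equiv.Perm.sameCycle_inv.1 hx))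
    rw [Equiv.apply_symm_apply, h0, mul_zero, zero_sub,
      if_neg (fun h => hvi (by rw [← h, Equiv.apply_symm_apply, h0])), neg_eq_zero] at this
    exact (mul_eq_zero.1 this).resolve_left hμ
  have := hv i hi
  rw [hvi, hvfi, if_pos rfl] at this
  simpa using this.symm

/-! ### A realization which is observable from a given state -/

open scoped Classical in
/-- The cycle of `f` through `j`, with weight `β`. -/
def cycleMatrix (f : Equiv.Perm ι) (j : ι) (β : ℝ) : Matrix ι ι ℝ :=
  Matrix.of fun x y => if f.SameCycle j x ∧ y = f x then β else 0

theorem cycleMatrix_mulVec (f : Equiv.Perm ι) (j : ι) (β : ℝ) (v : ι → ℂ)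
    (x : ι)    [Decidable (f.SameCycle j x)] :
    ((cycleMatrix f j β).map (algebraMap ℝ ℂ) *ᵥ v) x =
      if f.SameCycle j x then β * v (f x) else 0 := by
  classical
  simp only [Matrix.mulVec, dotProduct, cycleMatrix, Matrix.map_apply, Matrix.of_apply]
  split_ifs with h
  · rw [Finset.sum_eq_single (f x)] <;> simp +contextual [h]
  · simp [h]

/-- `M` is a realization, on the set `W`, which is observable from `b`. -/
structure ObservableOn (r : ι → ι → Prop) (f : Equiv.Perm ι) (b : ι) (M : Matrix ι ι ℝ)
    (W : Finset ι) : Prop where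
  mem : b ∈ W
  invariant : ∀ x, f x ∈ W ↔ x ∈ W
  support : ∀ x y, M x y ≠ 0 → r x y ∧ x ∈ W ∧ y ∈ W
  eq_zero : ∀ (μ : ℂ) (v : ι → ℂ),
    (∀ x ∈ W, (M.map (algebraMap ℝ ℂ) *ᵥ v) x = μ * v x) → v b = 0 → ∀ x ∈ W, v x = 0
  source_eq_zero : ∃ R : ℝ, 0 ≤ R ∧ ∀ (μ : ℂ), R < ‖μ‖ → ∀ i ∈ W, ∀ (t : ℂ) (v : ι → ℂ),
    (∀ x ∈ W, (M.map (algebraMap ℝ ℂ) *ᵥ v) x - μ * v x = if x = i then t else 0) →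
      v b = 0 → t = 0

open scoped Classical in
theorem observableOn_cycle {r : ι → ι → Prop} {f : Equiv.Perm ι} (hf : ∀ x, r x (f x)) (b : ι) :
    ObservableOn r f b (cycleMatrix f b 1) (Finset.univ.filter fun x => f.SameCycle b x) where
  mem := by simp [Equiv.Perm.SameCycle.refl]
  invariant := by simp
  support := by
    intro x y h
    simp only [cycleMatrix, Matrix.of_apply, ne_eq, ite_eq_right_iff, not_forall] at h
    obtain ⟨⟨h, rfl⟩, -⟩ := h
    simp [h, hf x]
  eq_zero := by
    intro μ v hv hb x hx
    refine eq_zero_on_cycle f one_pos (μ := μ) (fun x hx => ?_) hb x (by simpa using hx)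
    have := hv x (by simpa using hx)
    rwa [cycleMatrix_mulVec, if_pos hx] at this
  source_eq_zero := by
    refine ⟨0, le_rfl, fun μ hμ i hi t v hv hb => ?_⟩
    refine eq_zero_of_cycle_source f one_pos (norm_pos_iff.1 hμ) (i := i) (by simpa using hi)
      (fun x hx => ?_) hb
    have := hv x (by simpa using hx)
    rwa [cycleMatrix_mulVec, if_pos hx] at this

open scoped Classical in
-- The cycle of `j` is attached through the single entry `(i, j)`. Its modes have modulus equal to
-- its weight, which is chosen beyond the bound `R`. There a source in the old part is never
-- invisible at `b`, and `v j` acts as such a source at `i`.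
theorem ObservableOn.exists_union {r : ι → ι → Prop} {f : Equiv.Perm ι} (hf : ∀ x, r x (f x))
    {b : ι} {M : Matrix ι ι ℝ} {W : Finset ι} (h : ObservableOn r f b M W) {i j : ι}
    (hi : i ∈ W) (hj : j ∉ W) (hij : r i j) :
    ∃ M', ObservableOn r f b M' (W ∪ Finset.univ.filter fun x => f.SameCycle j x) := by
  obtain ⟨R, hR, hsource⟩ := h.source_eq_zero
  have hdisj : ∀ x, f.SameCycle j x → x ∉ W :=
    sameCycle_induction f (fun x => x ∉ W) hj fun x _ hx => by rwa [h.invariant]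
  have hdisj' : ∀ x ∈ W, ¬ f.SameCycle j x := fun x hx hc => hdisj x hc hx
  have hβ : 0 < R + 1 := by linarith
  set M' := M + Matrix.single i j 1 + cycleMatrix f j (R + 1) with hM'
  have hM : ∀ x ∉ W, ∀ v : ι → ℂ, (M.map (algebraMap ℝ ℂ) *ᵥ v) x = 0 := by
    intro x hx v
    refine Finset.sum_eq_zero fun y _ => ?_
    have : M x y = 0 := by_contra fun h0 => hx (h.support x y h0).2.1
    simp [this]
  have hsingle : ∀ x (v : ι → ℂ), ((Matrix.single i j (1 : ℝ)).map (algebraMap ℝ ℂ) *ᵥ v) x =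
      if x = i then v j else 0 := by
    intro x v
    rw [Matrix.map_single]
    simp only [map_one]
    by_cases hxi : x = i
    · subst hxi; simp [Matrix.single_mulVec]
    · rw [if_neg hxi]
      refine Finset.sum_eq_zero fun y _ => ?_
      simp [Ne.symm hxi]
  have hW : ∀ x ∈ W, ∀ v : ι → ℂ, (M'.map (algebraMap ℝ ℂ) *ᵥ v) x =
      (M.map (algebraMap ℝ ℂ) *ᵥ v) x + if x = i then v j else 0 := by
    intro x hx v
    rw [hM', Matrix.map_add _ (map_add _), Matrix.map_add _ (map_add _), Matrix.add_mulVec,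
      Matrix.add_mulVec, Pi.add_apply, Pi.add_apply, hsingle, cycleMatrix_mulVec,
      if_neg (hdisj' x hx), add_zero]
  have hC : ∀ x, f.SameCycle j x → ∀ v : ι → ℂ, (M'.map (algebraMap ℝ ℂ) *ᵥ v) x =
      ((R + 1 : ℝ) : ℂ) * v (f x) := by
    intro x hx v
    have hxi : x ≠ i := fun h => hdisj x hx (h ▸ hi)
    rw [hM', Matrix.map_add _ (map_add _), Matrix.map_add _ (map_add _), Matrix.add_mulVec,
      Matrix.add_mulVec, Pi.add_apply, Pi.add_apply, hsingle, cycleMatrix_mulVec, if_pos hx,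
      if_neg hxi, hM x (hdisj x hx), zero_add, zero_add]
  refine ⟨M', ?_, ?_, ?_, ?_, R + 1, hβ.le, ?_⟩
  · exact Finset.mem_union_left _ h.mem
  · intro x
    simp [h.invariant]
  · intro x y hxy
    by_cases h₁ : M x y = 0
    · by_cases h₂ : x = i ∧ y = j
      · obtain ⟨rfl, rfl⟩ := h₂
        simp [hij, hi, Equiv.Perm.SameCycle.refl]
      · have h₃ : cycleMatrix f j (R + 1) x y ≠ 0 := by
          intro h₃
          refine hxy ?_
          rw [hM', Matrix.add_apply, Matrix.add_apply, h₁, h₃, Matrix.single_apply,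
            if_neg (fun h => h₂ ⟨h.1.symm, h.2.symm⟩)]
          simp
        simp only [cycleMatrix, Matrix.of_apply, ne_eq, ite_eq_right_iff, not_forall] at h₃
        obtain ⟨⟨h₃, rfl⟩, -⟩ := h₃
        simp [h₃, hf x]
    · obtain ⟨h₁, h₂, h₃⟩ := h.support x y h₁
      simp [h₁, h₂, h₃]
  · intro μ v hv hb
    have hcyc : ∀ x, f.SameCycle j x → ((R + 1 : ℝ) : ℂ) * v (f x) = μ * v x :=
      fun x hx => hC x hx v ▸ hv x (by simp [hx])
    have hvW : ∀ x ∈ W, (M.map (algebraMap ℝ ℂ) *ᵥ v) x + (if x = i then v j else 0) = μ * v x :=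
      fun x hx => hW x hx v ▸ hv x (by simp [hx])
    -- A nonzero `v j` would force `‖μ‖ = R + 1`, within the range where the old part detects the
    -- source `-v j`.
    have hvj : v j = 0 := by
      by_contra hvj
      have hnorm := norm_eq_of_cycle f hβ hcyc hvj
      refine hvj (neg_eq_zero.1 (hsource μ (by linarith) i hi (-v j) v (fun x hx => ?_) hb))
      rw [← hvW x hx]
      split_ifs <;> ring
    intro x hx
    rcases Finset.mem_union.1 hx with hx | hx
    · refine h.eq_zero μ v (fun x hx => ?_) hb x hx
      rw [← hvW x hx, hvj]
      simp
    · exact eq_zero_on_cycle f hβ hcyc hvj x (by simpa using hx)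
  · intro μ hμ i' hi' t v hv hb
    have hcyc : ∀ x, f.SameCycle j x → ((R + 1 : ℝ) : ℂ) * v (f x) - μ * v x =
        if x = i' then t else 0 :=
      fun x hx => hC x hx v ▸ hv x (by simp [hx])
    have hvW : ∀ x ∈ W, (M.map (algebraMap ℝ ℂ) *ᵥ v) x + (if x = i then v j else 0) - μ * v x =
        if x = i' then t else 0 :=
      fun x hx => hW x hx v ▸ hv x (by simp [hx])
    rcases Finset.mem_union.1 hi' with hi' | hi'
    · have hvj : v j = 0 := by
        by_contra hvj
        refine hμ.ne' (norm_eq_of_cycle f hβ (fun x hx => sub_eq_zero.1 ?_) hvj)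
        rw [hcyc x hx, if_neg (fun h : x = i' => hdisj x hx (h ▸ hi'))]
      refine hsource μ (by linarith) i' hi' t v (fun x hx => ?_) hb
      rw [← hvW x hx, hvj]
      simp
    -- With the source on the new cycle, the old part first forces `v j = 0`, and then the cycle
    -- itself forces `t = 0`.
    · have hi' : f.SameCycle j i' := by simpa using hi'
      have hvj : v j = 0 := by
        refine neg_eq_zero.1 (hsource μ (by linarith) i hi (-v j) v (fun x hx => ?_) hb)
        have := hvW x hx
        rw [if_neg (fun h : x = i' => hdisj' x hx (h ▸ hi'))] at this
        split_ifs with hxi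
        · rw [if_pos hxi] at this
          linear_combination this
        · rw [if_neg hxi] at this
          linear_combination this
      refine eq_zero_of_cycle_source f hβ (norm_pos_iff.1 (hβ.trans hμ)) hi' hcyc hvj

/-- A structured matrix with a spanning family of disjoint cycles, all of whose states reach the
state `b`, has a realization which is observable from `b`. -/
theorem exists_observable {r : ι → ι → Prop} (f : Equiv.Perm ι) (hf : ∀ x, r x (f x)) {b : ι}
    (hb : ∀ x, Relation.ReflTransGen r b x) :
    ∃ M : Matrix ι ι ℝ, (∀ x y, M x y ≠ 0 → r x y) ∧ ∀ (μ : ℂ) (v : ι → ℂ),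
      M.map (algebraMap ℝ ℂ) *ᵥ v = μ • v → v b = 0 → v = 0 := by
  classical
  -- Maximality of `W` makes it closed under `r`, as otherwise another cycle could be attached;
  -- since `b` reaches everything, `W` is the whole type.
  obtain ⟨W, hW⟩ := (Set.toFinite {W : Finset ι | ∃ M, ObservableOn r f b M W}).exists_maximal
    ⟨_, _, observableOn_cycle hf b⟩
  obtain ⟨M, hM⟩ := hW.prop
  have hcl : ∀ i ∈ W, ∀ j, r i j → j ∈ W := by
    intro i hi j hij
    by_contra hj
    have := hW.le_of_ge (hM.exists_union hf hi hj hij) Finset.subset_union_left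
    exact hj (this (Finset.mem_union_right _ (by simp [Equiv.Perm.SameCycle.refl])))
  have huniv : ∀ x, x ∈ W := by
    intro x
    induction hb x with
    | refl => exact hM.mem
    | tail _ hyz ih => exact hcl _ ih _ hyz
  refine ⟨M, fun x y h => (hM.support x y h).1, fun μ v hv hvb => funext fun x => ?_⟩
  exact hM.eq_zero μ v (fun x _ => congrFun hv x) hvb x (huniv x)

/-! ### A realization with simple eigenvalues -/

/-- The permutation matrix of `f` with different weights on different cycles. -/
def weightedPermMatrix (f : Equiv.Perm ι) : Matrix ι ι ℝ :=
  Matrix.of fun x y => if y = f x then cycleWeight f x else 0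

/-- The modulus of `μ` is the weight of a cycle and so singles out one cycle. There `v` lives, `u`
does not vanish, and `u x * v x` is a nonzero constant. -/
theorem dotProduct_ne_zero_of_weightedPermMatrix (f : Equiv.Perm ι) {μ : ℂ} {u v : ι → ℂ}
    (hu : u ≠ 0) (hv : v ≠ 0)
    (huM : u ᵥ* (weightedPermMatrix f).map (algebraMap ℝ ℂ) = μ • u)
    (hvM : (weightedPermMatrix f).map (algebraMap ℝ ℂ) *ᵥ v = μ • v) : u ⬝ᵥ v ≠ 0 := by
  classical
  have hv' : ∀ x, cycleWeight f x * v (f x) = μ * v x := by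
    intro x
    have := congrFun hvM x
    simpa [Matrix.mulVec, dotProduct, weightedPermMatrix, apply_ite, ite_mul] using this
  have hu' : ∀ x, cycleWeight f x * u x = μ * u (f x) := by
    intro x
    have := congrFun huM (f x)
    simpa [Matrix.vecMul, dotProduct, weightedPermMatrix, apply_ite, mul_ite, mul_comm] using this
  have hvcyc : ∀ j x, f.SameCycle j x → cycleWeight f j * v (f x) = μ * v x := by
    intro j x hx
    rw [(cycleWeight_eq_iff f).2 hx, hv']
  have hucyc : ∀ j x, f⁻¹.SameCycle j x → cycleWeight f j * u (f⁻¹ x) = μ * u x := by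
    intro j x hx
    have hx := Equiv.Perm.sameCycle_inv.1 hx
    rw [(cycleWeight_eq_iff f).2 (Equiv.Perm.sameCycle_symm_apply_right.2 hx)]
    have := hu' (f.symm x)
    rwa [Equiv.apply_symm_apply] at this
  obtain ⟨j, hj⟩ := Function.ne_iff.1 hv
  obtain ⟨k, hk⟩ := Function.ne_iff.1 hu
  have hμj := norm_eq_of_cycle f (cycleWeight_pos f j) (hvcyc j) hj
  have hμk := norm_eq_of_cycle f⁻¹ (cycleWeight_pos f k) (hucyc k) hk
  have hjk : f.SameCycle j k := (cycleWeight_eq_iff f).1 (hμj.symm.trans hμk)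
  have huj : u j ≠ 0 := fun h => hk
    (eq_zero_on_cycle f⁻¹ (cycleWeight_pos f j) (hucyc j) h k (Equiv.Perm.sameCycle_inv.2 hjk))
  have hμ : μ ≠ 0 := norm_pos_iff.1 (hμj ▸ cycleWeight_pos f j)
  have hconst : ∀ x, f.SameCycle j x → u x * v x = u j * v j := by
    refine sameCycle_induction f _ rfl fun x _ hx => ?_
    have hw : (cycleWeight f x : ℂ) ≠ 0 := by exact_mod_cast (cycleWeight_pos f x).ne'
    rw [← hx]
    refine mul_left_cancel₀ (mul_ne_zero hw hμ) ?_
    linear_combination (μ * u (f x)) * hv' x - μ * v x * hu' x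
  have hzero : ∀ x, ¬ f.SameCycle j x → v x = 0 := by
    intro x hx
    by_contra h
    exact hx ((cycleWeight_eq_iff f).1
      (hμj.symm.trans (norm_eq_of_cycle f (cycleWeight_pos f x) (hvcyc x) h)))
  have hsum : u ⬝ᵥ v = ((Finset.univ.filter fun x => f.SameCycle j x).card : ℂ) * (u j * v j) := by
    rw [dotProduct, ← nsmul_eq_mul, ← Finset.sum_const, Finset.sum_filter]
    refine Finset.sum_congr rfl fun x _ => ?_
    split_ifs with hx
    · exact hconst x hx
    · rw [hzero x hx, mul_zero]
  rw [hsum]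
  refine mul_ne_zero ?_ (mul_ne_zero huj hj)
  rw [Nat.cast_ne_zero]
  exact (Finset.card_pos.2 ⟨j, by simp [Equiv.Perm.SameCycle.refl]⟩).ne'

end Permutations

section Generic

open Matrix Polynomial

/-! ### Generic realizations -/

open scoped Classical in
/-- The matrix of indeterminates with the pattern `r`. -/
def genericMatrix {ι : Type*} (r : ι → ι → Prop) :
    Matrix ι ι (MvPolynomial (ι × ι) ℝ) :=
  Matrix.of fun x y => if r x y then MvPolynomial.X (x, y) else 0

theorem genericMatrix_map_eval {ι : Type*} {r : ι → ι → Prop} {A : Matrix ι ι ℝ}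
    (hA : ∀ x y, A x y ≠ 0 → r x y) :
    (genericMatrix r).map (MvPolynomial.eval fun e => A e.1 e.2) = A := by
  ext x y
  by_cases h : r x y
  · simp [genericMatrix, h]
  · have : A x y = 0 := by_contra fun h0 => h (hA x y h0)
    simp [genericMatrix, h, this]

variable {ι : Type*} [Fintype ι] [DecidableEq ι]

/-- The determinant of `χ'(A)`, where `χ` is the characteristic polynomial of `A`: up to sign the
discriminant of `χ`. -/
def charpolyDisc {R : Type*} [CommRing R] (A : Matrix ι ι R) : R :=
  (aeval A A.charpoly.derivative).det

theorem map_charpolyDisc {R R' : Type*} [CommRing R] [CommRing R'] (φ : R →+* R')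
    (A : Matrix ι ι R) : φ (charpolyDisc A) = charpolyDisc (A.map φ) := by
  have h : φ.mapMatrix (aeval A A.charpoly.derivative) =
      aeval (A.map φ) (A.map φ).charpoly.derivative := by
    rw [Matrix.charpoly_map, derivative_map]
    have hcomm : (algebraMap R' (Matrix ι ι R')).comp φ =
        (φ.mapMatrix : Matrix ι ι R →+* Matrix ι ι R').comp (algebraMap R (Matrix ι ι R)) := by
      ext x i j
      by_cases h : i = j <;> simp [Matrix.algebraMap_matrix_apply, h]
    exact Polynomial.map_aeval_eq_aeval_map hcomm _ _
  rw [charpolyDisc, charpolyDisc, RingHom.map_det, h]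

/-- An eigenvector of `A` for `μ` is one of `χ'(A)` for `χ'(μ)`, which an invertible `χ'(A)` does
not allow to be zero. -/
theorem eval_derivative_charpoly_ne_zero {K : Type*} [Field K] {A : Matrix ι ι K}
    (hA : charpolyDisc A ≠ 0) {μ : K} (hμ : A.charpoly.IsRoot μ) :
    A.charpoly.derivative.eval μ ≠ 0 := by
  intro h0
  have hval : Module.End.HasEigenvalue (Matrix.toLin' A) μ := by
    rw [Module.End.hasEigenvalue_iff_isRoot_charpoly, Matrix.charpoly_toLin']
    exact hμ
  obtain ⟨v, hv⟩ := hval.exists_hasEigenvector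
  have h := Module.End.aeval_apply_of_hasEigenvector (p := A.charpoly.derivative) hv
  rw [h0, zero_smul] at h
  refine hv.2 (Matrix.eq_zero_of_mulVec_eq_zero hA ?_)
  rw [← h, ← Matrix.toLin'_apply]
  have := Polynomial.aeval_algHom_apply (Matrix.toLinAlgEquiv' (R := K) (n := ι)).toAlgHom A
    A.charpoly.derivative
  exact (congrArg (fun g : Module.End K (ι → K) => g v) this).symm

theorem charpolyDisc_ne_zero {K : Type*} [Field K] [IsAlgClosed K] {A : Matrix ι ι K}
    (h : ∀ μ, A.charpoly.IsRoot μ → A.charpoly.derivative.eval μ ≠ 0) : charpolyDisc A ≠ 0 := by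
  cases isEmpty_or_nonempty ι
  · simp [charpolyDisc]
  intro h0
  have hmem : (0 : K) ∈ spectrum K (aeval A A.charpoly.derivative) := by
    rw [spectrum.zero_mem_iff, Matrix.isUnit_iff_isUnit_det, isUnit_iff_ne_zero, not_not]
    exact h0
  rw [spectrum.map_polynomial_aeval_of_nonempty _ _
    (spectrum.nonempty_of_isAlgClosed_of_finiteDimensional K A)] at hmem
  obtain ⟨μ, hμ, hμ0⟩ := hmem
  exact h μ (Matrix.mem_spectrum_iff_isRoot_charpoly.1 hμ) hμ0

theorem charpolyDisc_weightedPermMatrix_ne_zero (f : Equiv.Perm ι) :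
    charpolyDisc (weightedPermMatrix f) ≠ 0 := by
  have h : charpolyDisc ((weightedPermMatrix f).map (algebraMap ℝ ℂ)) ≠ 0 :=
    charpolyDisc_ne_zero fun μ hμ => eval_derivative_charpoly_ne_zero_of_dotProduct_ne_zero _ μ
      (fun _ _ hu hv huM hvM => dotProduct_ne_zero_of_weightedPermMatrix f hu hv huM hvM) hμ
  rw [← map_charpolyDisc] at h
  exact fun h0 => h (by rw [h0, map_zero])

/-- Finitely many polynomials, none of which vanishes identically, have a common point at which
none of them vanishes. -/
theorem exists_eval_ne_zero {σ κ : Type*} [Fintype κ] (g : κ → MvPolynomial σ ℝ)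
    (hg : ∀ k, ∃ x, MvPolynomial.eval x (g k) ≠ 0) : ∃ x, ∀ k, MvPolynomial.eval x (g k) ≠ 0 := by
  have hprod : ∏ k, g k ≠ 0 := by
    refine Finset.prod_ne_zero_iff.2 fun k _ h => ?_
    obtain ⟨x, hx⟩ := hg k
    exact hx (by rw [h, map_zero])
  by_contra! hcon
  refine hprod (MvPolynomial.funext fun x => ?_)
  obtain ⟨k, hk⟩ := hcon x
  rw [map_prod, map_zero]
  exact Finset.prod_eq_zero (Finset.mem_univ k) hk

open scoped Classical in
/-- The determinant of the observability matrix of the part of `A` which reaches `b`, where `r` is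
the pattern of `A`. -/
def obsDet {R : Type*} [CommRing R] (r : ι → ι → Prop) (A : Matrix ι ι R) (b : ι) : R :=
  (obsMatrix (A.submatrix Subtype.val Subtype.val)
    (⟨b, Relation.ReflTransGen.refl⟩ : {x // Relation.ReflTransGen r b x})).det

theorem map_obsDet {R R' : Type*} [CommRing R] [CommRing R'] (φ : R →+* R') (r : ι → ι → Prop)
    (A : Matrix ι ι R) (b : ι) : φ (obsDet r A b) = obsDet r (A.map φ) b := by
  classical
  exact map_det_obsMatrix φ _ _

/-- The rows indexed by states reached from `b` have no entries outside that set, so the restriction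
of `v` to it is again subject to the eigenvector equation. -/
theorem eq_zero_of_obsDet_ne_zero {K : Type*} [Field K] {r : ι → ι → Prop} {A : Matrix ι ι K}
    (hA : ∀ x y, A x y ≠ 0 → r x y) {b : ι} (hdet : obsDet r A b ≠ 0) {μ : K} {v : ι → K}
    (hv : A *ᵥ v = μ • v) (hb : v b = 0) {x : ι} (hx : Relation.ReflTransGen r b x) : v x = 0 := by
  classical
  have h : (fun y : {x // Relation.ReflTransGen r b x} => v y) = 0 := by
    refine eq_zero_of_det_obsMatrix_ne_zero hdet (μ := μ) ?_ hb
    ext y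
    have hy := congrFun hv y
    rw [Pi.smul_apply] at hy ⊢
    rw [← hy]
    simp only [Matrix.mulVec, dotProduct, Matrix.submatrix_apply]
    refine (Finset.sum_subtype (Finset.univ.filter fun z => Relation.ReflTransGen r b z)
      (by simp) fun z => A y z * v z).symm.trans (Finset.sum_subset (Finset.subset_univ _) ?_)
    intro z _ hz
    have : A y z = 0 := by_contra fun h0 => hz (by simpa using y.2.tail (hA _ _ h0))
    rw [this, zero_mul]
  exact congrFun h ⟨x, hx⟩

theorem exists_obsDet_ne_zero {r : ι → ι → Prop} (f : Equiv.Perm ι) (hf : ∀ x, r x (f x)) (b : ι) :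
    ∃ A : Matrix ι ι ℝ, (∀ x y, A x y ≠ 0 → r x y) ∧ obsDet r A b ≠ 0 := by
  classical
  let Q := {x // Relation.ReflTransGen r b x}
  have hmaps : ∀ x, Relation.ReflTransGen r b x ↔ Relation.ReflTransGen r b (f x) := by
    intro x
    refine ⟨fun h => h.tail (hf x), fun h => ?_⟩
    -- Backward closure comes from going forward: the cycle returns from `f x` to `x`.
    refine sameCycle_induction f (fun y => Relation.ReflTransGen r b y) h
      (fun y _ hy => hy.tail (hf y)) x ?_
    exact Equiv.Perm.sameCycle_apply_left.2 (Equiv.Perm.SameCycle.refl f x)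
  let g : Equiv.Perm Q := f.subtypePerm fun x => (hmaps x).symm
  obtain ⟨M, hMr, hM⟩ := exists_observable (r := fun x y : Q => r x y) g (fun x => hf x)
    (b := ⟨b, .refl⟩) (by
      rintro ⟨x, hx⟩
      induction hx with
      | refl => exact .refl
      | tail hy hyz ih => exact ih.tail hyz)
  refine ⟨Matrix.of fun x y => if h : Relation.ReflTransGen r b x ∧ Relation.ReflTransGen r b y
    then M ⟨x, h.1⟩ ⟨y, h.2⟩ else 0, fun x y hxy => ?_, ?_⟩
  · simp only [Matrix.of_apply] at hxy
    split_ifs at hxy with h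
    · exact hMr _ _ hxy
    · exact absurd rfl hxy
  · have hdet := det_obsMatrix_ne_zero hM
    rw [← map_det_obsMatrix] at hdet
    intro h0
    refine hdet ?_
    rw [← map_zero (algebraMap ℝ ℂ), ← h0]
    unfold obsDet
    congr 3
    ext x y
    simp [x.2, y.2]

/-- A structured matrix with a spanning family of disjoint cycles has a realization with simple
eigenvalues which is observable from every state and controllable from every state, as far as
its digraph admits. -/
theorem exists_generic {r : ι → ι → Prop} (f : Equiv.Perm ι) (hf : ∀ x, r x (f x)) :
    ∃ A : Matrix ι ι ℝ, (∀ x y, A x y ≠ 0 → r x y) ∧ charpolyDisc A ≠ 0 ∧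
      (∀ b, obsDet r A b ≠ 0) ∧ ∀ a, obsDet (Function.swap r) Aᵀ a ≠ 0 := by
  let G := genericMatrix r
  -- Each condition is the nonvanishing of one polynomial in the entries. Each gets its own witness,
  -- and a common point follows; controllability is observability of the transpose.
  let g : Unit ⊕ (ι ⊕ ι) → MvPolynomial (ι × ι) ℝ :=
    Sum.elim (fun _ => charpolyDisc G)
      (Sum.elim (fun b => obsDet r G b) fun a => obsDet (Function.swap r) Gᵀ a)
  obtain ⟨x, hx⟩ := exists_eval_ne_zero g (by
    rintro (_ | b | a)
    · have hw : ∀ x y, weightedPermMatrix f x y ≠ 0 → r x y := by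
        intro x y h
        simp only [weightedPermMatrix, Matrix.of_apply, ne_eq, ite_eq_right_iff, not_forall] at h
        obtain ⟨rfl, -⟩ := h
        exact hf x
      refine ⟨fun e => weightedPermMatrix f e.1 e.2, ?_⟩
      show MvPolynomial.eval _ (charpolyDisc G) ≠ 0
      rw [map_charpolyDisc, genericMatrix_map_eval hw]
      exact charpolyDisc_weightedPermMatrix_ne_zero f
    · obtain ⟨A, hA, hdet⟩ := exists_obsDet_ne_zero f hf b
      refine ⟨fun e => A e.1 e.2, ?_⟩
      show MvPolynomial.eval _ (obsDet r G b) ≠ 0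
      rwa [map_obsDet, genericMatrix_map_eval hA]
    · obtain ⟨A, hA, hdet⟩ := exists_obsDet_ne_zero (r := Function.swap r) f.symm
        (fun x => by simpa [Function.swap] using hf (f.symm x)) a
      refine ⟨fun e => Aᵀ e.1 e.2, ?_⟩
      show MvPolynomial.eval _ (obsDet (Function.swap r) Gᵀ a) ≠ 0
      rw [map_obsDet, Matrix.transpose_map,
        genericMatrix_map_eval (A := Aᵀ) (fun x y h => hA y x h), Matrix.transpose_transpose]
      exact hdet)
  refine ⟨G.map (MvPolynomial.eval x), fun i j h => ?_, ?_, fun b => ?_, fun a => ?_⟩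
  · by_contra hr
    exact h (by simp [G, genericMatrix, hr])
  · rw [← map_charpolyDisc]
    exact hx (Sum.inl ())
  · rw [← map_obsDet]
    exact hx (Sum.inr (Sum.inl b))
  · rw [← Matrix.transpose_map, ← map_obsDet]
    exact hx (Sum.inr (Sum.inr a))

/-- A structured matrix with a spanning family of disjoint cycles has a realization such that to
each eigenvalue `μ` there is a state `x` with the following property: the entry `(b, a)` of the
adjugate of `μ - A` is nonzero whenever there are paths from `a` to `x` and from `x` to `b`. -/
theorem exists_realization_adjugate_ne_zero {r : ι → ι → Prop} (f : Equiv.Perm ι)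
    (hf : ∀ x, r x (f x)) :
    ∃ A : Matrix ι ι ℝ, (∀ x y, A x y ≠ 0 → r x y) ∧
      ∀ μ : ℂ, (Matrix.scalar ι μ - A.map (algebraMap ℝ ℂ)).det = 0 → ∃ x, ∀ a b,
        Relation.ReflTransGen r b x → Relation.ReflTransGen r x a →
          (Matrix.scalar ι μ - A.map (algebraMap ℝ ℂ)).adjugate b a ≠ 0 := by
  obtain ⟨A, hA, hdisc, hobs, hctr⟩ := exists_generic f hf
  refine ⟨A, hA, fun μ hμ => ?_⟩
  set Ac := A.map (algebraMap ℝ ℂ) with hAc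
  set D := (Matrix.scalar ι μ - Ac).adjugate with hD
  have hinj : Function.Injective (algebraMap ℝ ℂ) := (algebraMap ℝ ℂ).injective
  have hAc' : ∀ x y, Ac x y ≠ 0 → r x y := fun x y h => hA x y fun h0 => h (by simp [hAc, h0])
  have hobs' : ∀ b, obsDet r Ac b ≠ 0 := fun b => by
    rw [hAc, ← map_obsDet]
    exact (map_ne_zero_iff _ hinj).2 (hobs b)
  have hctr' : ∀ a, obsDet (Function.swap r) Acᵀ a ≠ 0 := fun a => by
    rw [hAc, ← Matrix.transpose_map, ← map_obsDet]
    exact (map_ne_zero_iff _ hinj).2 (hctr a)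
  -- The trace is the derivative of the characteristic polynomial at `μ`, nonzero because the root
  -- is simple.
  have htrace : D.trace ≠ 0 := by
    rw [hD, ← eval_derivative_charpoly]
    refine eval_derivative_charpoly_ne_zero ?_ ?_
    · rw [hAc, ← map_charpolyDisc]
      exact (map_ne_zero_iff _ hinj).2 hdisc
    · rwa [IsRoot.def, Matrix.eval_charpoly]
  obtain ⟨x, -, hx⟩ := Finset.exists_ne_zero_of_sum_ne_zero htrace
  have hcol : ∀ a, Ac *ᵥ (fun b => D b a) = μ • fun b => D b a := by
    intro a
    have h := Matrix.mul_adjugate (Matrix.scalar ι μ - Ac)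
    rw [hμ, zero_smul, Matrix.sub_mul, sub_eq_zero, ← hD, Matrix.scalar_apply,
      ← Matrix.smul_one_eq_diagonal, Matrix.smul_mul, Matrix.one_mul] at h
    ext b
    have := congrFun (congrFun h b) a
    simpa [Matrix.mul_apply, Matrix.mulVec, dotProduct] using this.symm
  have hrow : ∀ b, Acᵀ *ᵥ (fun a => D b a) = μ • fun a => D b a := by
    intro b
    have h := Matrix.adjugate_mul (Matrix.scalar ι μ - Ac)
    rw [hμ, zero_smul, Matrix.mul_sub, sub_eq_zero, ← hD, Matrix.scalar_apply,
      ← Matrix.smul_one_eq_diagonal, Matrix.mul_smul, Matrix.mul_one] at h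
    ext a
    have := congrFun (congrFun h b) a
    simpa [Matrix.mul_apply, Matrix.mulVec, dotProduct, mul_comm] using this.symm
  refine ⟨x, fun a b hbx hxa h0 => hx ?_⟩
  -- The zero moves along row `b` from `a` to `x`, then along column `x` from `b` to `x`,
  -- contradicting the choice of `x`.
  have h₁ : D b x = 0 := by
    refine eq_zero_of_obsDet_ne_zero (r := Function.swap r) (fun x y h => hAc' y x h) (hctr' a)
      (hrow b) h0 ?_
    exact Relation.reflTransGen_swap.2 hxa
  exact eq_zero_of_obsDet_ne_zero hAc' (hobs' b) (hcol x) h₁ hbx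

end Generic

/-- The determinant is linear in row `a`, and the coefficient of its entry `b` is the corresponding
cofactor. -/
theorem det_sub_single {ι R : Type*} [Fintype ι] [DecidableEq ι] [CommRing R] (M : Matrix ι ι R)
    (a b : ι) : (M - Matrix.single a b 1).det = M.det - M.adjugate b a := by
  have h : M - Matrix.single a b 1 = M.updateRow a (M a + -Pi.single b 1) := by
    ext x y
    by_cases hx : x = a
    · subst hx
      simp [Matrix.single_apply, Pi.single_apply, sub_eq_add_neg, eq_comm]
    · simp [Matrix.updateRow_ne hx, Ne.symm hx]
  rw [h, Matrix.det_updateRow_add, Matrix.updateRow_eq_self, Matrix.adjugate_apply,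
    ← neg_one_smul R (Pi.single b 1 : ι → R), Matrix.det_updateRow_smul]
  ring

namespace StructuredSystem

variable {n m p : ℕ} (S : StructuredSystem n m p)

/-! ### Coverings avoid structurally fixed modes -/

theorem HasPerfectMatching.exists_perm {S : StructuredSystem n m p} (h : S.HasPerfectMatching) :
    ∃ f : Equiv.Perm (Fin n), ∀ i, S.A i (f i) = true := by
  obtain ⟨M, hM, hspan⟩ := h
  have hex : ∀ j : Fin n, ∃ i : Fin n, M.Adj (.inl j) (.inr i) := by
    intro j
    obtain ⟨w, hw, -⟩ := hM (hspan (.inl j))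
    cases w with
    | inl i => exact (M.adj_sub hw).elim
    | inr i => exact ⟨i, hw⟩
  choose f hf using hex
  have hinj : Function.Injective f := by
    intro j j' h
    exact Sum.inl_injective
      ((hM (hspan (.inr (f j)))).unique (hf j).symm (h ▸ (hf j').symm))
  exact ⟨Equiv.ofBijective f (Finite.injective_iff_bijective.1 hinj), fun j => M.adj_sub (hf j)⟩

theorem noStructurallyFixedModes_of_covered (hS : S.IsDedicated) (hmatching : S.HasPerfectMatching)
    {K : StructuredMatrix m p}
    (hK : ∀ N, ∃ e : FeedbackEdge m p, K e.2 e.1 = true ∧ e ∈ S.coveringEdges N) :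
    S.NoStructurallyFixedModes K := by
  classical
  obtain ⟨f, hf⟩ := hmatching.exists_perm
  obtain ⟨A, hA, hadj⟩ := exists_realization_adjugate_ne_zero (r := fun i j => S.A i j = true) f hf
  refine ⟨A, Matrix.of fun i k => if S.B i k = true then 1 else 0,
    Matrix.of fun l j => if S.C l j = true then 1 else 0, ?_, ?_, ?_, ?_⟩
  · intro i j h
    by_contra h0
    simp [hA i j h0] at h
  · intro i j h
    simp [h]
  · intro i j h
    simp [h]
  refine Set.eq_empty_iff_forall_notMem.2 fun μ hμ => ?_
  rw [Set.mem_iInter₂] at hμ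
  -- Zero gain shows that a fixed mode is an eigenvalue of `A`.
  have hμ₀ := hμ 0 fun i j _ => rfl
  rw [Matrix.mul_zero, Matrix.zero_mul, add_zero, Matrix.mem_spectrum_iff_isRoot_charpoly,
    Polynomial.IsRoot.def, Matrix.eval_charpoly] at hμ₀
  obtain ⟨x, hx⟩ := hadj μ hμ₀
  obtain ⟨⟨l, k⟩, hkl, hcov⟩ := hK (S.scc x)
  obtain ⟨⟨b, hb, hCb⟩, a, ha, hBa⟩ := S.mem_coveringEdges_iff.1 hcov
  have hKkl : Realizes (Matrix.single k l 1) K := by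
    intro k' l' h
    rw [Matrix.single_apply, if_neg]
    rintro ⟨rfl, rfl⟩
    simp [hkl] at h
  have hμ₁ := hμ (Matrix.single k l 1) hKkl
  -- Since inputs and outputs are dedicated, unit gain on one feedback edge changes a single entry
  -- of `A`.
  have hprod : (Matrix.of fun i k => if S.B i k = true then (1 : ℝ) else 0) *
      (Matrix.single k l 1 : Matrix (Fin m) (Fin p) ℝ) *
        (Matrix.of fun l j => if S.C l j = true then (1 : ℝ) else 0) =
        Matrix.single a b 1 := by
    have hB : ∀ i, S.B i k = true ↔ a = i :=
      fun i => ⟨fun h => (hS.1 k).unique hBa h, fun h => h ▸ hBa⟩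
    have hC : ∀ j, S.C l j = true ↔ b = j :=
      fun j => ⟨fun h => (hS.2 l).unique hCb h, fun h => h ▸ hCb⟩
    ext i j
    rw [Matrix.mul_apply, Finset.sum_eq_single l, Matrix.mul_single_apply_same]
    · by_cases h : a = i <;> simp [hB, hC, Matrix.single_apply, h]
    · intro l' _ hl'
      rw [Matrix.mul_single_apply_of_ne _ _ _ _ _ hl', zero_mul]
    · simp
  rw [hprod, Matrix.mem_spectrum_iff_isRoot_charpoly, Polynomial.IsRoot.def, Matrix.eval_charpoly,
    Matrix.map_add _ (map_add _), Matrix.map_single, map_one, ← sub_sub, det_sub_single, hμ₀,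
    zero_sub, neg_eq_zero] at hμ₁
  refine hx a b ?_ ?_ hμ₁
  -- The pattern relation, read by row and column, is the reverse of the edges of the state digraph.
  · exact Relation.reflTransGen_swap.1 (S.ancestor_scc_iff.1 hb)
  · exact Relation.reflTransGen_swap.1 (S.ancestor_scc_iff.1 ha)

end StructuredSystem
end FeedbackSelection

end

theorem theorem8 {n m p : ℕ} (S : FeedbackSelection.StructuredSystem n m p)
    (P : FeedbackSelection.CostMatrix m p)
    (hdedicated : S.IsDedicated)
    (hback : S.BackEdgeAssumption P)
    (root : S.SCC) (hroot : FeedbackSelection.IsHierarchical S.sccDAG root)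
    (hmatching : S.HasPerfectMatching)
    (enum : ℕ → List S.SCC) (henum : S.IsLayerEnumeration root enum)
    (tie : S.TieBreak) :
    (∀ (H : Finset (FeedbackSelection.FeedbackEdge m p)) (c : ENNReal),
      S.hierarchicalAlgorithm P root enum tie = some (H, c) →
        S.IsOptimalSolution P (FeedbackSelection.StructuredSystem.feedbackMatrix H) ∧
        c = FeedbackSelection.StructuredSystem.matrixCost P
          (FeedbackSelection.StructuredSystem.feedbackMatrix H)) ∧
    (S.feasibleSet.Nonempty →
      ∃ (H : Finset (FeedbackSelection.FeedbackEdge m p)) (c : ENNReal),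
        S.hierarchicalAlgorithm P root enum tie = some (H, c)) := by
  classical
  refine ⟨fun H c h => ?_, fun ⟨K, hK⟩ => ?_⟩
  · have hsol := S.hierarchicalAlgorithm_solvesTree hdedicated.2 hroot P tie henum h
    have hc : c = FeedbackSelection.StructuredSystem.matrixCost P
        (FeedbackSelection.StructuredSystem.feedbackMatrix H) :=
      hsol.cost_eq.trans (FeedbackSelection.StructuredSystem.edgeCost_eq_matrixCost P H _
        fun e => by simp [FeedbackSelection.StructuredSystem.feedbackMatrix])
    refine ⟨⟨S.noStructurallyFixedModes_of_covered hdedicated hmatching fun N => ?_, ?_⟩, hc⟩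
    · obtain ⟨e, he, hcov⟩ := hsol.covers N (S.ancestor_root hroot N)
      exact ⟨e, by simpa [FeedbackSelection.StructuredSystem.feedbackMatrix] using he, hcov⟩
    · intro K hK
      rw [← hc]
      -- A competitor of infinite cost is harmless; finite cost leaves only back edges, for which
      -- covering is necessary.
      rcases eq_or_ne (FeedbackSelection.StructuredSystem.matrixCost P K) ⊤ with htop | hfin
      · rw [htop]
        exact le_top
      have hP : ∀ i j, K i j = true → P i j ≠ ⊤ := by
        intro i j hij hPij
        refine hfin (ENNReal.sum_eq_top.2 ⟨i, Finset.mem_univ _, ENNReal.sum_eq_top.2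
          ⟨j, Finset.mem_univ _, ?_⟩⟩)
        rw [if_pos hij, hPij]
      rw [← FeedbackSelection.StructuredSystem.edgeCost_eq_matrixCost P
        (Finset.univ.filter fun e => K e.2 e.1 = true) K (by simp)]
      refine hsol.le_cost _ fun N _ => ?_
      obtain ⟨e, he, hcov⟩ := S.exists_mem_coveringEdges_of_backEdges hroot
        (fun i j k l hB hkl hC => S.ancestor_states_of_ancestor hdedicated hB hC
          (by_contra fun hn => hP k l hkl (hback k l hn))) hK N
      exact ⟨e, by simpa using he, hcov⟩
  · obtain ⟨⟨H, c⟩, h⟩ := S.exists_hierarchicalAlgorithm_eq_some P tie root enum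
      (S.coveringEdges_nonempty hK)
    exact ⟨H, c, h⟩
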